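/- Let $m$ be a natural number and let $\{\mathbf x_k\}_{k\in\mathbb Z}$ and $\{\mathbf y_k\}_{k\in\mathbb Z}$ be zero-mean, discrete-time stochastic processes with values in $\mathbb R^m$ and finite second moments. For $a\in\mathbb Z$ and $n\ge 0$ write $\mathbf x_{a,\ldots,a+n}=[\mathbf x_a^{\mathrm T},\ldots,\mathbf x_{a+n}^{\mathrm T}]^{\mathrm T}\in\mathbb R^{(n+1)m}$, and likewise for $\mathbf y$. Assume: (i) (stationarity) $\mathbb E[\mathbf x_i\mathbf x_{i+k}^{\mathrm T}]=R_{\mathbf x}(k)$ and $\mathbb E[\mathbf y_i\mathbf y_{i+k}^{\mathrm T}]=R_{\mathbf y}(k)$ do not depend on $i$; (ii) (ellipticity with the same density generator) for every $n\ge0$ there is a measurable function $g_n:\mathbb R\to[0,\infty)$ such that, for every $a\in\mathbb Z$, the vectors $\mathbf x_{a,\ldots,a+n}$ and $\mathbf y_{a,\ldots,a+n}$ have probability densities of the form $v\mapsto \det(S)^{-1/2}\,g_n(v^{\mathrm T}S^{-1}v)$, each with its own positive definite matrix $S$; (iii) the series $\Phi_{\mathbf x}(\omega)=\sum_{k=-\infty}^{\infty}R_{\mathbf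 x}(k)\mathrm e^{-\mathrm j\omega k}$ and $\Phi_{\mathbf y}(\omega)=\sum_{k=-\infty}^{\infty}R_{\mathbf y}(k)\mathrm e^{-\mathrm j\omega k}$ defining the power spectra converge absolutely, and $\Phi_{\mathbf x}(\omega)$, $\Phi_{\mathbf y}(\omega)$ are positive definite for every real $\omega$. Define the average $\mathcal W_2$ distance between the laws of the two processes by $$\mathcal W_2\left(p_{\{\mathbf x_k\}};p_{\{\mathbf y_k\}}\right)=\left(\inf\ \limsup_{i\to\infty}\frac{\mathbb E\left[\|\mathbf x_{0,\ldots,i}-\mathbf y_{0,\ldots,i}\|^2\right]}{i+1}\right)^{1/2},$$ where the infimum is over all couplings of the two processes, that is, over all joint laws of $(\{\mathbf x_k\},\{\mathbf y_k\})$ whose marginals are the given laws $p_{\{\mathbf x_k\}}$ and $p_{\{\mathbf y_k\}}$, and $\|\cdot\|$ is the Euclidean norm. Put $$W[\Phi_{\mathbf x}(\omega),\Phi_{\mathbf y}(\omega)]=\Phi_{\mathbf x}(\omega)+\Phi_{\mathbf y}(\omega)-2\left[\Phi_{\mathbf x}^{1/2}(\omega)\,\Phi_{\mathbf y}(\omega)\,\Phi_{\mathbf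 x}^{1/2}(\omega)\right]^{1/2}.$$ Then $\omega\mapsto\operatorname{tr}W[\Phi_{\mathbf x}(\omega),\Phi_{\mathbf y}(\omega)]$ is integrable on $[0,2\pi]$ and $$\mathcal W_2\left(p_{\{\mathbf x_k\}};p_{\{\mathbf y_k\}}\right)=\sqrt{\frac1{2\pi}\int_0^{2\pi}\operatorname{tr}\left\{W[\Phi_{\mathbf x}(\omega),\Phi_{\mathbf y}(\omega)]\right\}\mathrm d\omega}.$$ -/

import Mathlib

open MeasureTheory Filter
open scoped ENNReal NNReal MatrixOrder ComplexOrder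

noncomputable section

namespace SpectralWasserstein

/-- The random vector `x_{a,…,a+n}` obtained by stacking `n + 1` consecutive values of a path. -/
def block {m : ℕ} (a : ℤ) (n : ℕ) (x : ℤ → EuclideanSpace ℝ (Fin m)) :
    EuclideanSpace ℝ (Fin (n + 1) × Fin m) :=
  WithLp.toLp 2 fun p => x (a + ((p.1 : ℕ) : ℤ)) p.2

/-- The law, on path space, of a discrete-time process. -/
def processLaw {m : ℕ} {Ω : Type*} [MeasurableSpace Ω] (P : Measure Ω)
    (x : ℤ → Ω → EuclideanSpace ℝ (Fin m)) : Measure (ℤ → EuclideanSpace ℝ (Fin m)) :=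
  P.map fun s k => x k s

/-- The couplings of two measures. -/
def couplings {α β : Type*} [MeasurableSpace α] [MeasurableSpace β]
    (μ : Measure α) (ν : Measure β) : Set (Measure (α × β)) :=
  {γ | γ.map Prod.fst = μ ∧ γ.map Prod.snd = ν}

/-- The average `W_p` distance between two laws of processes:
the `p`-th root of the infimum over all couplings of
`limsup_i E ‖x_{0,…,i} - y_{0,…,i}‖ ^ p / (i + 1)`. -/
def avgWasserstein {m : ℕ} (p : ℝ) (μ ν : Measure (ℤ → EuclideanSpace ℝ (Fin m))) : ℝ≥0∞ :=
  (⨅ γ ∈ couplings μ ν,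
    limsup (fun i : ℕ => (∫⁻ z, ‖block 0 i z.1 - block 0 i z.2‖ₑ ^ p ∂γ) / ((i : ℝ≥0∞) + 1))
      atTop) ^ (1 / p)

/-- The auto-correlation `R(i, k) = E[x_i x_{i+k}ᵀ]`. -/
def autocorr {m : ℕ} {Ω : Type*} [MeasurableSpace Ω] (P : Measure Ω)
    (x : ℤ → Ω → EuclideanSpace ℝ (Fin m)) (i k : ℤ) : Matrix (Fin m) (Fin m) ℝ :=
  Matrix.of fun a b => ∫ s, x i s a * x (i + k) s b ∂P

/-- Stationarity of a process with finite second moments: `R(i, k)` depends only on `k`. -/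
structure IsStationary {m : ℕ} {Ω : Type*} [MeasurableSpace Ω] (P : Measure Ω)
    (x : ℤ → Ω → EuclideanSpace ℝ (Fin m)) : Prop where
  memLp : ∀ k, MemLp (x k) 2 P
  autocorr_eq : ∀ i j k, autocorr P x i k = autocorr P x j k

/-- The term `R(k) e^{-jωk}` of the power spectrum of a stationary process,
with `R(k) = R(0, k)`. -/
def spectrumTerm {m : ℕ} {Ω : Type*} [MeasurableSpace Ω] (P : Measure Ω)
    (x : ℤ → Ω → EuclideanSpace ℝ (Fin m)) (w : ℝ) (k : ℤ) : Matrix (Fin m) (Fin m) ℂ :=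
  Complex.exp (-(Complex.I * w * k)) • (autocorr P x 0 k).map ((↑) : ℝ → ℂ)

/-- The power spectrum `Φ(ω) = ∑_{k ∈ ℤ} R(k) e^{-jωk}` of a stationary process. -/
def powerSpectrum {m : ℕ} {Ω : Type*} [MeasurableSpace Ω] (P : Measure Ω)
    (x : ℤ → Ω → EuclideanSpace ℝ (Fin m)) (w : ℝ) : Matrix (Fin m) (Fin m) ℂ :=
  ∑' k : ℤ, spectrumTerm P x w k

/-- A measure on a Euclidean space is a centred elliptical distribution with density generator
`g` if, for some positive definite scatter matrix `S`, it has the density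
`det(S)^{-1/2} g(vᵀ S⁻¹ v)` (the normalizing constant is part of `g`). -/
def IsElliptical {ι : Type*} [Fintype ι] [DecidableEq ι] (μ : Measure (EuclideanSpace ℝ ι))
    (g : ℝ → ℝ≥0) : Prop :=
  Measurable g ∧ ∃ S : Matrix ι ι ℝ, S.PosDef ∧
    μ = volume.withDensity fun v : EuclideanSpace ℝ ι =>
      ENNReal.ofReal ((√S.det)⁻¹ * (g (v.ofLp ⬝ᵥ S⁻¹.mulVec v.ofLp) : ℝ))

/-- A (zero-mean) elliptical process: each vector `x_{a,…,a+n}` is elliptical. The density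
generator of a vector depends on its dimension, so the density generator of a process is a
family `g`, where `g n` is the one of the vectors of `n + 1` consecutive values. -/
def IsEllipticalProcess {m : ℕ} {Ω : Type*} [MeasurableSpace Ω] (P : Measure Ω)
    (x : ℤ → Ω → EuclideanSpace ℝ (Fin m)) (g : ℕ → ℝ → ℝ≥0) : Prop :=
  ∀ (a : ℤ) (n : ℕ), IsElliptical (P.map fun s => block a n fun k => x k s) (g n)

/-- `W[A, B] = A + B - 2 (A^{1/2} B A^{1/2})^{1/2}`. -/
def buresMatrix {m : ℕ} (A B : Matrix (Fin m) (Fin m) ℂ) : Matrix (Fin m) (Fin m) ℂ :=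
  A + B - (2 : ℂ) • CFC.sqrt (CFC.sqrt A * B * CFC.sqrt A)

end SpectralWasserstein

end

/-!
In `L²` a stationary process is a family of vectors whose Gram kernel is the Fourier transform of
its power spectrum `Φ`, so a linear filter with frequency response `f` has output of squared norm
`(2π)⁻¹ ∫ fᴴ Φ f`. The cost of a coupling up to time `n` is the Cesàro mean of
`∑ₐ ‖ξ (k, a) - η (k, a)‖²`, that is `tr E Φ + tr E Ψ` (with `E` the mean over a period) minus twice
the Cesàro mean of the cross-correlations at lag zero.

*Lower bound.* Along an ultrafilter the Cesàro means of the cross-correlations converge, and the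
limit is invariant under time shifts even if the coupling is not stationary. Cauchy–Schwarz and
AM–GM hold for the limit form. Inserting the filters with responses `T^{1/2}` and `T^{-1/2}`, where
`T` is the optimal transport map from `Φ` to `Ψ`, bounds the limit at lag zero by the mean of
`tr (Φ^{1/2} Ψ Φ^{1/2})^{1/2}`.

*Attainment.* The output of the filter with response `T` applied to `x` has spectrum `Ψ` and the
optimal cost. A linear functional of an elliptical vector is determined in law by its variance and
the density generator, so this output has the law of `y`.
-/

noncomputable section

namespace SpectralWasserstein

open Matrix Topology ComplexConjugate

section Matrices

variable {ι : Type*} [Fintype ι] [DecidableEq ι]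

theorem posDef_sqrt {𝕜 : Type*} [RCLike 𝕜] {A : Matrix ι ι 𝕜} (hA : A.PosDef) :
    (CFC.sqrt A).PosDef := by
  have hu : IsUnit (CFC.sqrt A * CFC.sqrt A) := by
    rw [CFC.sqrt_mul_sqrt_self A hA.posSemidef.nonneg]
    exact hA.isUnit
  exact (CFC.sqrt_nonneg A).posSemidef.posDef_iff_isUnit.2 (isUnit_of_mul_isUnit_left hu)

theorem conjTranspose_sqrt {𝕜 : Type*} [RCLike 𝕜] (A : Matrix ι ι 𝕜) :
    (CFC.sqrt A)ᴴ = CFC.sqrt A :=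
  (CFC.sqrt_nonneg A).posSemidef.isHermitian

theorem inv_sqrt_mul_self {𝕜 : Type*} [RCLike 𝕜] {A : Matrix ι ι 𝕜} (hA : A.PosDef) :
    (CFC.sqrt A)⁻¹ * A = CFC.sqrt A := by
  nth_rw 2 [← CFC.sqrt_mul_sqrt_self A hA.posSemidef.nonneg]
  exact nonsing_inv_mul_cancel_left _ _ ((isUnit_iff_isUnit_det _).1 (posDef_sqrt hA).isUnit)

theorem self_mul_inv_sqrt {𝕜 : Type*} [RCLike 𝕜] {A : Matrix ι ι 𝕜} (hA : A.PosDef) :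
    A * (CFC.sqrt A)⁻¹ = CFC.sqrt A := by
  nth_rw 1 [← CFC.sqrt_mul_sqrt_self A hA.posSemidef.nonneg]
  exact mul_nonsing_inv_cancel_right _ _ ((isUnit_iff_isUnit_det _).1 (posDef_sqrt hA).isUnit)

theorem mapMatrix_conj_posSemidef {A : Matrix ι ι ℂ} (hA : A.PosSemidef) :
    ((starRingEnd ℂ).mapMatrix A).PosSemidef := by
  have hT : (starRingEnd ℂ).mapMatrix A = Aᵀ := by
    conv_rhs => rw [← hA.isHermitian.eq]
    rfl
  exact hT ▸ hA.transpose

theorem sqrt_mapMatrix_conj {A : Matrix ι ι ℂ} (hA : A.PosSemidef) :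
    CFC.sqrt ((starRingEnd ℂ).mapMatrix A) = (starRingEnd ℂ).mapMatrix (CFC.sqrt A) := by
  refine CFC.sqrt_unique ?_ (mapMatrix_conj_posSemidef (CFC.sqrt_nonneg A).posSemidef).nonneg
  rw [← map_mul, CFC.sqrt_mul_sqrt_self A hA.nonneg]

theorem inv_mapMatrix {R S : Type*} [CommRing R] [CommRing S] (f : R →+* S) {A : Matrix ι ι R}
    (hA : IsUnit A) : (f.mapMatrix A)⁻¹ = f.mapMatrix A⁻¹ := by
  refine Matrix.inv_eq_right_inv ?_
  rw [← map_mul, Matrix.mul_nonsing_inv _ ((Matrix.isUnit_iff_isUnit_det _).1 hA), map_one]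

section Continuity

variable {X : Type*} [TopologicalSpace X] {A : X → Matrix ι ι ℂ}

open scoped Matrix.Norms.L2Operator in
theorem continuous_sqrt_matrix (hA : Continuous A) (hA0 : ∀ w, (A w).PosSemidef) :
    Continuous fun w => CFC.sqrt (A w) :=
  Continuous.cfcₙ_nnreal_of_mem_nhdsSet (s := Set.univ) NNReal.sqrt Filter.univ_mem hA
    (fun w => (hA0 w).nonneg) NNReal.continuous_sqrt.continuousOn

theorem continuous_inv_matrix (hA : Continuous A) (hA0 : ∀ w, IsUnit (A w)) :
    Continuous fun w => (A w)⁻¹ := by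
  refine continuous_iff_continuousAt.2 fun w => ?_
  have hdet := NormedRing.inverse_continuousAt ((Matrix.isUnit_iff_isUnit_det _).1 (hA0 w)).unit
  exact ContinuousAt.comp (continuousAt_matrix_inv _ hdet) hA.continuousAt

end Continuity

/-- The cross term `(A^{1/2} B A^{1/2})^{1/2}` of the Bures distance. -/
def fidelity (A B : Matrix ι ι ℂ) : Matrix ι ι ℂ := CFC.sqrt (CFC.sqrt A * B * CFC.sqrt A)

/-- The optimal transport map `A^{-1/2} (A^{1/2} B A^{1/2})^{1/2} A^{-1/2}` between centred Gaussian
laws with covariances `A` and `B`. -/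
def transportMap (A B : Matrix ι ι ℂ) : Matrix ι ι ℂ :=
  (CFC.sqrt A)⁻¹ * fidelity A B * (CFC.sqrt A)⁻¹

variable {A B : Matrix ι ι ℂ}

theorem posDef_sqrt_mul_mul_sqrt (hA : A.PosDef) (hB : B.PosDef) :
    (CFC.sqrt A * B * CFC.sqrt A).PosDef := by
  have h := (Matrix.IsUnit.posDef_star_left_conjugate_iff (x := B) (posDef_sqrt hA).isUnit).2 hB
  rwa [star_eq_conjTranspose, conjTranspose_sqrt] at h

theorem posDef_fidelity (hA : A.PosDef) (hB : B.PosDef) : (fidelity A B).PosDef :=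
  posDef_sqrt (posDef_sqrt_mul_mul_sqrt hA hB)

theorem fidelity_mul_self (hA : A.PosDef) (hB : B.PosDef) :
    fidelity A B * fidelity A B = CFC.sqrt A * B * CFC.sqrt A :=
  CFC.sqrt_mul_sqrt_self _ (posDef_sqrt_mul_mul_sqrt hA hB).posSemidef.nonneg

theorem posDef_transportMap (hA : A.PosDef) (hB : B.PosDef) : (transportMap A B).PosDef := by
  have hS := (posDef_sqrt hA).inv
  have h := (Matrix.IsUnit.posDef_star_left_conjugate_iff (x := fidelity A B) hS.isUnit).2
    (posDef_fidelity hA hB)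
  rwa [star_eq_conjTranspose, hS.isHermitian.eq] at h

theorem transportMap_mul_mul_transportMap (hA : A.PosDef) (hB : B.PosDef) :
    transportMap A B * A * transportMap A B = B := by
  have hu := (Matrix.isUnit_iff_isUnit_det _).1 (posDef_sqrt hA).isUnit
  have hS : (CFC.sqrt A)⁻¹ * A * (CFC.sqrt A)⁻¹ = 1 := by
    rw [inv_sqrt_mul_self hA, mul_nonsing_inv _ hu]
  calc transportMap A B * A * transportMap A B
      = (CFC.sqrt A)⁻¹ * fidelity A B * ((CFC.sqrt A)⁻¹ * A * (CFC.sqrt A)⁻¹) * fidelity A B *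
          (CFC.sqrt A)⁻¹ := by simp only [transportMap, mul_assoc]
    _ = (CFC.sqrt A)⁻¹ * (CFC.sqrt A * B * CFC.sqrt A) * (CFC.sqrt A)⁻¹ := by
      rw [hS, ← fidelity_mul_self hA hB, mul_one, mul_assoc _ (fidelity A B) (fidelity A B)]
    _ = B := by
      rw [mul_assoc (CFC.sqrt A), Matrix.nonsing_inv_mul_cancel_left _ _ hu,
        Matrix.mul_nonsing_inv_cancel_right _ _ hu]

theorem trace_mul_transportMap (hA : A.PosDef) :
    (A * transportMap A B).trace = (fidelity A B).trace := by
  have hu := (Matrix.isUnit_iff_isUnit_det _).1 (posDef_sqrt hA).isUnit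
  calc (A * transportMap A B).trace
      = (A * (CFC.sqrt A)⁻¹ * fidelity A B * (CFC.sqrt A)⁻¹).trace := by
        simp only [transportMap, mul_assoc]
    _ = (CFC.sqrt A * (fidelity A B * (CFC.sqrt A)⁻¹)).trace := by
        rw [self_mul_inv_sqrt hA, mul_assoc]
    _ = (fidelity A B).trace := by rw [trace_mul_comm, nonsing_inv_mul_cancel_right _ _ hu]

theorem trace_conj_sqrt_transportMap (hA : A.PosDef) (hB : B.PosDef) :
    ((CFC.sqrt (transportMap A B))ᴴ * A * CFC.sqrt (transportMap A B)).trace =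
      (fidelity A B).trace := by
  rw [conjTranspose_sqrt, mul_assoc, trace_mul_comm, mul_assoc,
    CFC.sqrt_mul_sqrt_self _ (posDef_transportMap hA hB).posSemidef.nonneg,
    trace_mul_transportMap hA]

theorem trace_conj_inv_sqrt_transportMap (hA : A.PosDef) (hB : B.PosDef) :
    ((CFC.sqrt (transportMap A B))⁻¹ᴴ * B * (CFC.sqrt (transportMap A B))⁻¹).trace =
      (fidelity A B).trace := by
  have hT := posDef_transportMap hA hB
  calc ((CFC.sqrt (transportMap A B))⁻¹ᴴ * B * (CFC.sqrt (transportMap A B))⁻¹).trace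
      = ((CFC.sqrt (transportMap A B))⁻¹ * transportMap A B * A *
          (transportMap A B * (CFC.sqrt (transportMap A B))⁻¹)).trace := by
        nth_rw 2 [← transportMap_mul_mul_transportMap hA hB]
        simp only [conjTranspose_nonsing_inv, conjTranspose_sqrt, mul_assoc]
    _ = ((CFC.sqrt (transportMap A B))ᴴ * A * CFC.sqrt (transportMap A B)).trace := by
        rw [inv_sqrt_mul_self hT, self_mul_inv_sqrt hT, conjTranspose_sqrt]
    _ = (fidelity A B).trace := trace_conj_sqrt_transportMap hA hB

end Matrices

section RealSymbols

variable {ι : Type*} [Fintype ι] [DecidableEq ι]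

/-- A continuous `2π`-periodic matrix function which is the frequency response of a filter with real
coefficients. -/
structure IsRealSymbol (A : ℝ → Matrix ι ι ℂ) : Prop where
  continuous : Continuous A
  periodic : Function.Periodic A (2 * Real.pi)
  neg : ∀ w, A (-w) = (starRingEnd ℂ).mapMatrix (A w)

namespace IsRealSymbol

variable {A B : ℝ → Matrix ι ι ℂ}

theorem mul (hA : IsRealSymbol A) (hB : IsRealSymbol B) : IsRealSymbol fun w => A w * B w where
  continuous := hA.continuous.matrix_mul hB.continuous
  periodic w := by simp only [hA.periodic w, hB.periodic w]
  neg w := by simp only [hA.neg, hB.neg, map_mul]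

theorem sqrt (hA : IsRealSymbol A) (hA0 : ∀ w, (A w).PosSemidef) :
    IsRealSymbol fun w => CFC.sqrt (A w) where
  continuous := continuous_sqrt_matrix hA.continuous hA0
  periodic w := by simp only [hA.periodic w]
  neg w := by simp only [hA.neg, sqrt_mapMatrix_conj (hA0 w)]

theorem inv (hA : IsRealSymbol A) (hA0 : ∀ w, IsUnit (A w)) : IsRealSymbol fun w => (A w)⁻¹ where
  continuous := continuous_inv_matrix hA.continuous hA0
  periodic w := by simp only [hA.periodic w]
  neg w := by simp only [hA.neg, inv_mapMatrix _ (hA0 w)]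

theorem fidelity (hA : IsRealSymbol A) (hB : IsRealSymbol B)
    (hA0 : ∀ w, (A w).PosDef) (hB0 : ∀ w, (B w).PosDef) :
    IsRealSymbol fun w => fidelity (A w) (B w) :=
  have hS := hA.sqrt fun w => (hA0 w).posSemidef
  ((hS.mul hB).mul hS).sqrt fun w => (posDef_sqrt_mul_mul_sqrt (hA0 w) (hB0 w)).posSemidef

theorem transportMap (hA : IsRealSymbol A) (hB : IsRealSymbol B)
    (hA0 : ∀ w, (A w).PosDef) (hB0 : ∀ w, (B w).PosDef) :
    IsRealSymbol fun w => transportMap (A w) (B w) :=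
  have hS := (hA.sqrt fun w => (hA0 w).posSemidef).inv fun w => (posDef_sqrt (hA0 w)).isUnit
  (hS.mul (hA.fidelity hB hA0 hB0)).mul hS

end IsRealSymbol

end RealSymbols

section TrigonometricApproximation

theorem exists_trigPoly_near {f : ℝ → ℂ} (hf : Continuous f)
    (hp : Function.Periodic f (2 * Real.pi)) {ε : ℝ} (hε : 0 < ε) :
    ∃ c : ℤ →₀ ℂ, ∀ w : ℝ,
      ‖(c.sum fun k z => z * Complex.exp (Complex.I * w * k)) - f w‖ ≤ ε := by
  have : Fact (0 < 2 * Real.pi) := ⟨Real.two_pi_pos⟩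
  let F : C(AddCircle (2 * Real.pi), ℂ) := ⟨hp.lift, continuous_coinduced_dom.2 hf⟩
  have hF : F ∈ (Submodule.span ℂ
      (Set.range (@fourier (2 * Real.pi)))).topologicalClosure := by
    rw [span_fourier_closure_eq_top]
    trivial
  rw [← SetLike.mem_coe, Submodule.topologicalClosure_coe, Metric.mem_closure_iff] at hF
  obtain ⟨g, hg, hd⟩ := hF ε hε
  obtain ⟨c, hc⟩ := Finsupp.mem_span_range_iff_exists_finsupp.1 hg
  refine ⟨c, fun w => ?_⟩
  have hcg : (c.sum fun k z => z * Complex.exp (Complex.I * w * k)) = g (w : AddCircle _) := by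
    rw [← hc, Finsupp.sum, Finsupp.sum, ContinuousMap.sum_apply]
    refine Finset.sum_congr rfl fun k _ => ?_
    rw [ContinuousMap.smul_apply, fourier_coe_apply, smul_eq_mul]
    have hpi : (Real.pi : ℂ) ≠ 0 := by exact_mod_cast Real.pi_ne_zero
    congr 2
    push_cast
    field_simp
  have hfF : f w = F (w : AddCircle _) := (hp.lift_coe w).symm
  rw [hcg, hfF, ← dist_eq_norm, dist_comm]
  exact (ContinuousMap.dist_apply_le_dist _).trans hd.le

theorem exists_real_trigPoly_near {f : ℝ → ℂ} (hf : Continuous f)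
    (hp : Function.Periodic f (2 * Real.pi)) (hn : ∀ w, f (-w) = conj (f w))
    {ε : ℝ} (hε : 0 < ε) :
    ∃ c : ℤ →₀ ℝ, ∀ w : ℝ,
      ‖(c.sum fun k r => (r : ℂ) * Complex.exp (Complex.I * w * k)) - f w‖ ≤ ε := by
  obtain ⟨c, hc⟩ := exists_trigPoly_near hf hp hε
  set q : ℝ → ℂ := fun w => c.sum fun k z => z * Complex.exp (Complex.I * w * k) with hq
  refine ⟨c.mapRange Complex.re Complex.zero_re, fun w => ?_⟩
  -- Taking real parts of the coefficients symmetrizes the polynomial, as it does nothing to `f`.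
  have hre : ((c.mapRange Complex.re Complex.zero_re).sum
      fun k r => (r : ℂ) * Complex.exp (Complex.I * w * k)) = (q w + conj (q (-w))) / 2 := by
    rw [Finsupp.sum_mapRange_index (by simp)]
    simp only [hq, Finsupp.sum, map_sum]
    rw [← Finset.sum_add_distrib, Finset.sum_div]
    refine Finset.sum_congr rfl fun k _ => ?_
    have hexp : conj (Complex.I * ((-w : ℝ) : ℂ) * (k : ℂ)) = Complex.I * w * k := by simp
    rw [map_mul, ← Complex.exp_conj, hexp, ← add_mul, Complex.add_conj]
    push_cast
    ring
  have hdiff : (q w + conj (q (-w))) / 2 - f w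
      = ((q w - f w) + conj (q (-w) - f (-w))) / 2 := by
    rw [map_sub, hn, Complex.conj_conj]
    ring
  rw [hre, hdiff, norm_div, Complex.norm_ofNat]
  have htri := norm_add_le (q w - f w) (conj (q (-w) - f (-w)))
  rw [RCLike.norm_conj] at htri
  linarith [hc w, hc (-w)]

end TrigonometricApproximation

section FrequencyResponses

variable {ι : Type*}

theorem conj_exp_mul_exp (w : ℝ) (k : ℤ) :
    conj (Complex.exp (Complex.I * w * k)) * Complex.exp (Complex.I * w * k) = 1 := by
  rw [← Complex.exp_conj, ← Complex.exp_add]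
  simp

/-- A continuous `2π`-periodic vector function with conjugate symmetry: the frequency response of a
filter with real coefficients. -/
structure IsRealVec (f : ℝ → ι → ℂ) : Prop where
  continuous : Continuous f
  periodic : Function.Periodic f (2 * Real.pi)
  neg : ∀ w, f (-w) = star (f w)

namespace IsRealVec

variable {f g : ℝ → ι → ℂ}

theorem zero : IsRealVec (0 : ℝ → ι → ℂ) where
  continuous := continuous_zero
  periodic _ := rfl
  neg _ := star_zero _ |>.symm

theorem add (hf : IsRealVec f) (hg : IsRealVec g) : IsRealVec (f + g) where
  continuous := hf.continuous.add hg.continuous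
  periodic := hf.periodic.add hg.periodic
  neg w := by simp only [Pi.add_apply, hf.neg, hg.neg, star_add]

theorem smul (hf : IsRealVec f) (r : ℝ) : IsRealVec (r • f) where
  continuous := hf.continuous.const_smul r
  periodic := hf.periodic.smul r
  neg w := by simp only [Pi.smul_apply, hf.neg, star_smul, star_trivial]

theorem mulVec [Fintype ι] [DecidableEq ι] {A : ℝ → Matrix ι ι ℂ} (hA : IsRealSymbol A)
    (hf : IsRealVec f) : IsRealVec fun w => A w *ᵥ f w where
  continuous := hA.continuous.matrix_mulVec hf.continuous
  periodic w := by simp only [hA.periodic w, hf.periodic w]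
  neg w := by
    ext a
    simp only [Matrix.mulVec, dotProduct, hA.neg, hf.neg, RingHom.mapMatrix_apply,
      Matrix.map_apply, Pi.star_apply, star_sum, star_mul', starRingEnd_apply]

theorem exists_bound [Fintype ι] (hf : IsRealVec f) : ∃ C, ∀ w, ‖f w‖ ≤ C := by
  obtain ⟨C, hC⟩ := isCompact_Icc.exists_bound_of_continuousOn
    (s := Set.Icc (0 : ℝ) (0 + 2 * Real.pi)) hf.continuous.continuousOn
  refine ⟨C, fun w => ?_⟩
  obtain ⟨v, hv, hvw⟩ := hf.periodic.exists_mem_Ico Real.two_pi_pos w 0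
  exact hvw ▸ hC v (Set.Ico_subset_Icc_self hv)

end IsRealVec

variable [DecidableEq ι]

/-- The response `e^{jωk} e_a` of the filter that returns the coordinate `a` at time `k`, for
`p = (k, a)`. -/
def coordResp (p : ℤ × ι) (w : ℝ) : ι → ℂ := Pi.single p.2 (Complex.exp (Complex.I * w * p.1))

/-- The frequency response `∑ u(k, a) e^{jωk} e_a` of a finitely supported real filter `u`. -/
def freqResp : (ℤ × ι →₀ ℝ) →ₗ[ℝ] ℝ → ι → ℂ := Finsupp.linearCombination ℝ coordResp

theorem freqResp_single_one (p : ℤ × ι) : freqResp (Finsupp.single p 1) = coordResp p := by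
  rw [freqResp, Finsupp.linearCombination_single, one_smul]

theorem freqResp_mapDomain_apply (c : ℤ →₀ ℝ) (a b : ι) (w : ℝ) :
    freqResp (c.mapDomain fun k => (k, a)) w b =
      if b = a then c.sum fun k r => (r : ℂ) * Complex.exp (Complex.I * w * k) else 0 := by
  rw [freqResp, Finsupp.linearCombination_mapDomain, Finsupp.linearCombination_apply, Finsupp.sum,
    Finset.sum_apply, Finset.sum_apply]
  split_ifs with hb
  · subst hb
    simp [coordResp, Finsupp.sum]
  · simp [coordResp, hb]

theorem isRealVec_coordResp (p : ℤ × ι) : IsRealVec (coordResp p) where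
  continuous := by
    refine (continuous_single p.2).comp ?_
    fun_prop
  periodic w := by
    have hexp : Complex.exp (Complex.I * ↑(w + 2 * Real.pi) * p.1) =
        Complex.exp (Complex.I * w * p.1) :=
      Complex.exp_eq_exp_iff_exists_int.2 ⟨p.1, by push_cast; ring⟩
    simp only [coordResp, hexp]
  neg w := by
    rw [coordResp, coordResp, ← Pi.single_star, ← starRingEnd_apply, ← Complex.exp_conj]
    simp

theorem isRealVec_freqResp (u : ℤ × ι →₀ ℝ) : IsRealVec (freqResp u) := by
  induction u using Finsupp.induction_linear with
  | zero => exact map_zero (freqResp (ι := ι)) ▸ .zero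
  | add u v hu hv => exact map_add freqResp u v ▸ hu.add hv
  | single p r =>
    rw [freqResp, Finsupp.linearCombination_single]
    exact (isRealVec_coordResp p).smul r

variable [Fintype ι]

theorem IsRealVec.exists_freqResp_near {f : ℝ → ι → ℂ} (hf : IsRealVec f) {ε : ℝ} (hε : 0 < ε) :
    ∃ u : ℤ × ι →₀ ℝ, ∀ w, ‖freqResp u w - f w‖ ≤ ε := by
  have hcoord := fun a => exists_real_trigPoly_near (f := fun w => f w a)
    ((continuous_apply a).comp hf.continuous) (fun w => by simp only [hf.periodic w])
    (fun w => congrFun (hf.neg w) a) hε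
  choose c hc using hcoord
  refine ⟨∑ a, (c a).mapDomain fun k => (k, a), fun w => ?_⟩
  refine (pi_norm_le_iff_of_nonneg hε.le).2 fun a => ?_
  rw [Pi.sub_apply, map_sum, Finset.sum_apply, Finset.sum_apply]
  simpa only [freqResp_mapDomain_apply, Finset.sum_ite_eq, Finset.mem_univ, if_true] using hc a w

/-- Pointwise convergence of vector functions with a uniform bound. -/
structure BddTendsto {κ : Type*} (U : κ → ℝ → ι → ℂ) (l : Filter κ) (f : ℝ → ι → ℂ) : Prop where
  bound : ∃ C, ∀ i w, ‖U i w‖ ≤ C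
  tendsto : ∀ w, Tendsto (fun i => U i w) l (𝓝 (f w))

namespace BddTendsto

omit [DecidableEq ι]

variable {κ : Type*} {U V : κ → ℝ → ι → ℂ} {l : Filter κ} {f g : ℝ → ι → ℂ}

theorem sub (hU : BddTendsto U l f) (hV : BddTendsto V l g) :
    BddTendsto (fun i => U i - V i) l (f - g) where
  bound := by
    obtain ⟨C, hC⟩ := hU.bound
    obtain ⟨D, hD⟩ := hV.bound
    exact ⟨C + D, fun i w => (norm_sub_le _ _).trans (add_le_add (hC i w) (hD i w))⟩
  tendsto w := (hU.tendsto w).sub (hV.tendsto w)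

theorem comp (hU : BddTendsto U l f) {κ' : Type*} {l' : Filter κ'} {φ : κ' → κ}
    (hφ : Tendsto φ l' l) : BddTendsto (fun i => U (φ i)) l' f where
  bound := hU.bound.imp fun _ hC i w => hC (φ i) w
  tendsto w := (hU.tendsto w).comp hφ

theorem sum {σ : Type*} (s : Finset σ) {U : σ → κ → ℝ → ι → ℂ} {f : σ → ℝ → ι → ℂ}
    (hU : ∀ c, BddTendsto (U c) l (f c)) :
    BddTendsto (fun i => ∑ c ∈ s, U c i) l (∑ c ∈ s, f c) where
  bound := by
    choose C hC using fun c => (hU c).bound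
    refine ⟨∑ c ∈ s, C c, fun i w => ?_⟩
    rw [Finset.sum_apply]
    exact norm_sum_le_of_le _ fun c _ => hC c i w
  tendsto w := by
    simp only [Finset.sum_apply]
    exact tendsto_finsetSum _ fun c _ => (hU c).tendsto w

theorem conj_apply_smul (hU : BddTendsto U l f) (hV : BddTendsto V l g) (a : ι) :
    BddTendsto (fun i w => conj (U i w a) • V i w) l (fun w => conj (f w a) • g w) where
  bound := by
    obtain ⟨C, hC⟩ := hU.bound
    obtain ⟨D, hD⟩ := hV.bound
    refine ⟨C * D, fun i w => ?_⟩
    rw [norm_smul, RCLike.norm_conj]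
    exact mul_le_mul ((norm_le_pi_norm _ a).trans (hC i w)) (hD i w) (norm_nonneg _)
      ((norm_nonneg _).trans (hC i w))
  tendsto w := ((Complex.continuous_conj.tendsto _).comp
    (((continuous_apply a).tendsto _).comp (hU.tendsto w))).smul (hV.tendsto w)

end BddTendsto

theorem IsRealVec.exists_bddTendsto {f : ℝ → ι → ℂ} (hf : IsRealVec f) :
    ∃ u : ℕ → ℤ × ι →₀ ℝ, BddTendsto (fun n => freqResp (u n)) atTop f := by
  choose u hu using fun n : ℕ =>
    hf.exists_freqResp_near (Nat.one_div_pos_of_nat (α := ℝ) (n := n))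
  obtain ⟨C, hC⟩ := hf.exists_bound
  refine ⟨u, ⟨C + 1, fun n w => ?_⟩, fun w => ?_⟩
  · have htri : ‖freqResp (u n) w‖ ≤ ‖f w‖ + ‖freqResp (u n) w - f w‖ :=
      norm_le_norm_add_norm_sub' _ _
    linarith [hC w, hu n w, Nat.one_div_le_one_div (α := ℝ) n.zero_le]
  · rw [tendsto_iff_norm_sub_tendsto_zero]
    exact squeeze_zero (fun _ => norm_nonneg _) (fun n => hu n w)
      tendsto_one_div_add_atTop_nhds_zero_nat

end FrequencyResponses

section SpectralForm

variable {ι : Type*} [Fintype ι]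

/-- The real form `(2π)⁻¹ ∫ Re (f(ω)ᴴ Φ(ω) g(ω)) dω`: the covariance of the outputs of two filters
with responses `f` and `g`, when the input has spectrum `Φ`. -/
def specForm (Φ : ℝ → Matrix ι ι ℂ) (f g : ℝ → ι → ℂ) : ℝ :=
  1 / (2 * Real.pi) * ∫ w in (0 : ℝ)..(2 * Real.pi), (star (f w) ⬝ᵥ Φ w *ᵥ g w).re

/-- The average `(2π)⁻¹ ∫ Re tr M(ω) dω` over a period. -/
def meanTrace (M : ℝ → Matrix ι ι ℂ) : ℝ :=
  1 / (2 * Real.pi) * ∫ w in (0 : ℝ)..(2 * Real.pi), (M w).trace.re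

theorem norm_star_dotProduct_mulVec_le (M : Matrix ι ι ℂ) (p q : ι → ℂ) :
    ‖star p ⬝ᵥ M *ᵥ q‖ ≤ (∑ a, ∑ b, ‖M a b‖) * ‖p‖ * ‖q‖ := by
  simp only [dotProduct, mulVec, Finset.sum_mul, Finset.mul_sum]
  refine norm_sum_le_of_le _ fun a _ => norm_sum_le_of_le _ fun b _ => ?_
  rw [norm_mul, norm_mul, Pi.star_apply, norm_star]
  calc ‖p a‖ * (‖M a b‖ * ‖q b‖) = ‖M a b‖ * ‖p a‖ * ‖q b‖ := by ring
    _ ≤ ‖M a b‖ * ‖p‖ * ‖q‖ := by gcongr <;> exact norm_le_pi_norm _ _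

variable {Φ : ℝ → Matrix ι ι ℂ} {f g : ℝ → ι → ℂ}

theorem continuous_specForm_integrand (hΦ : Continuous Φ) (hf : Continuous f) (hg : Continuous g) :
    Continuous fun w => (star (f w) ⬝ᵥ Φ w *ᵥ g w).re :=
  Complex.continuous_re.comp (hf.star.dotProduct (hΦ.matrix_mulVec hg))

theorem specForm_mulVec (A B : ℝ → Matrix ι ι ℂ) :
    specForm Φ (fun w => A w *ᵥ f w) (fun w => B w *ᵥ g w) =
      specForm (fun w => (A w)ᴴ * Φ w * B w) f g := by
  simp only [specForm, star_mulVec, ← mulVec_mulVec, dotProduct_mulVec, vecMul_vecMul]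

theorem tendsto_specForm {κ : Type*} {l : Filter κ} [l.IsCountablyGenerated]
    {U V : κ → ℝ → ι → ℂ} (hΦ : Continuous Φ)
    (hUc : ∀ i, Continuous (U i)) (hVc : ∀ i, Continuous (V i))
    (hU : BddTendsto U l f) (hV : BddTendsto V l g) :
    Tendsto (fun i => specForm Φ (U i) (V i)) l (𝓝 (specForm Φ f g)) := by
  obtain ⟨C, hC⟩ := hU.bound
  obtain ⟨D, hD⟩ := hV.bound
  refine Tendsto.const_mul _ ?_
  refine intervalIntegral.tendsto_integral_filter_of_dominated_convergence
    (fun w => (∑ a, ∑ b, ‖Φ w a b‖) * C * D) (.of_forall fun i =>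
      (continuous_specForm_integrand hΦ (hUc i) (hVc i)).aestronglyMeasurable)
    (.of_forall fun i => .of_forall fun w _ => ?_) ?_ (.of_forall fun w _ => ?_)
  · refine (Complex.abs_re_le_norm _).trans ((norm_star_dotProduct_mulVec_le _ _ _).trans ?_)
    have hC0 : 0 ≤ C := (norm_nonneg _).trans (hC i w)
    gcongr
    exacts [hC i w, hD i w]
  · refine Continuous.intervalIntegrable ?_ _ _
    have hentry : ∀ a b, Continuous fun w => Φ w a b := fun a b => hΦ.matrix_elem a b
    fun_prop
  · have hc : Continuous fun z : (ι → ℂ) × (ι → ℂ) => (star z.1 ⬝ᵥ Φ w *ᵥ z.2).re :=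
      Complex.continuous_re.comp
        (continuous_fst.star.dotProduct (continuous_const.matrix_mulVec continuous_snd))
    have hz := (hc.tendsto (f w, g w)).comp ((hU.tendsto w).prodMk_nhds (hV.tendsto w))
    simpa only [Function.comp_def] using hz

variable [DecidableEq ι]

theorem specForm_freqResp_left (hΦ : Continuous Φ) (hg : Continuous g) (u : ℤ × ι →₀ ℝ) :
    specForm Φ (freqResp u) g = u.sum fun p r => r * specForm Φ (coordResp p) g := by
  have hint : ∀ p : ℤ × ι, IntervalIntegrable
      (fun w => (star (coordResp p w) ⬝ᵥ Φ w *ᵥ g w).re) volume 0 (2 * Real.pi) := fun p =>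
    (continuous_specForm_integrand hΦ (isRealVec_coordResp p).continuous hg).intervalIntegrable _ _
  have hsum : ∀ w, (star (freqResp u w) ⬝ᵥ Φ w *ᵥ g w).re =
      ∑ p ∈ u.support, u p * (star (coordResp p w) ⬝ᵥ Φ w *ᵥ g w).re := fun w => by
    simp only [freqResp, Finsupp.linearCombination_apply, Finsupp.sum, Finset.sum_apply,
      Pi.smul_apply, star_sum, star_smul, star_trivial, sum_dotProduct, smul_dotProduct,
      Complex.re_sum, Complex.smul_re, smul_eq_mul]
  simp only [specForm, hsum, Finsupp.sum]
  rw [intervalIntegral.integral_finsetSum fun p _ => (hint p).const_mul _, Finset.mul_sum]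
  exact Finset.sum_congr rfl fun p _ => by rw [intervalIntegral.integral_const_mul]; ring

theorem specForm_freqResp_right (hΦ : Continuous Φ) (hf : Continuous f) (u : ℤ × ι →₀ ℝ) :
    specForm Φ f (freqResp u) = u.sum fun p r => r * specForm Φ f (coordResp p) := by
  have hint : ∀ p : ℤ × ι, IntervalIntegrable
      (fun w => (star (f w) ⬝ᵥ Φ w *ᵥ coordResp p w).re) volume 0 (2 * Real.pi) := fun p =>
    (continuous_specForm_integrand hΦ hf (isRealVec_coordResp p).continuous).intervalIntegrable _ _
  have hsum : ∀ w, (star (f w) ⬝ᵥ Φ w *ᵥ freqResp u w).re =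
      ∑ p ∈ u.support, u p * (star (f w) ⬝ᵥ Φ w *ᵥ coordResp p w).re := fun w => by
    simp only [freqResp, Finsupp.linearCombination_apply, Finsupp.sum, Finset.sum_apply,
      Pi.smul_apply, mulVec_sum, mulVec_smul, dotProduct_sum, dotProduct_smul,
      Complex.re_sum, Complex.smul_re, smul_eq_mul]
  simp only [specForm, hsum, Finsupp.sum]
  rw [intervalIntegral.integral_finsetSum fun p _ => (hint p).const_mul _, Finset.mul_sum]
  exact Finset.sum_congr rfl fun p _ => by rw [intervalIntegral.integral_const_mul]; ring

theorem sum_specForm_coordResp (hΦ : Continuous Φ) (k : ℤ) :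
    ∑ a, specForm Φ (coordResp (k, a)) (coordResp (k, a)) = meanTrace Φ := by
  have hint : ∀ a, IntervalIntegrable
      (fun w => (star (coordResp (k, a) w) ⬝ᵥ Φ w *ᵥ coordResp (k, a) w).re)
      volume 0 (2 * Real.pi) := fun a =>
    (continuous_specForm_integrand hΦ (isRealVec_coordResp (k, a)).continuous
      (isRealVec_coordResp (k, a)).continuous).intervalIntegrable _ _
  simp only [specForm, meanTrace]
  rw [← Finset.mul_sum, ← intervalIntegral.integral_finsetSum fun a _ => hint a]
  congr 2 with w
  rw [trace, Complex.re_sum]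
  refine Finset.sum_congr rfl fun a _ => ?_
  rw [coordResp, ← Pi.single_star, single_dotProduct, mulVec_single, Pi.smul_apply,
    MulOpposite.smul_eq_mul_unop, MulOpposite.unop_op, mul_left_comm, ← starRingEnd_apply,
    conj_exp_mul_exp, mul_one]
  rfl

end SpectralForm

section ShiftsAndAdjoints

variable {ι : Type*}

/-- The time shift of a filter. -/
def shift (k : ℤ) : (ℤ × ι →₀ ℝ) →ₗ[ℝ] (ℤ × ι →₀ ℝ) :=
  Finsupp.lmapDomain ℝ ℝ fun p => (p.1 + k, p.2)

theorem shift_single (k : ℤ) (p : ℤ × ι) (r : ℝ) :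
    shift k (Finsupp.single p r) = Finsupp.single (p.1 + k, p.2) r :=
  Finsupp.mapDomain_single

theorem shift_shift (k l : ℤ) (u : ℤ × ι →₀ ℝ) : shift k (shift l u) = shift (l + k) u := by
  refine (Finsupp.mapDomain_comp ..).symm.trans ?_
  simp only [Function.comp_def, add_assoc]
  rfl

theorem shift_zero (u : ℤ × ι →₀ ℝ) : shift 0 u = u := by
  rw [shift, Finsupp.lmapDomain_apply]
  simp only [add_zero]
  exact Finsupp.mapDomain_id

variable [DecidableEq ι]

theorem freqResp_shift (k : ℤ) (u : ℤ × ι →₀ ℝ) (w : ℝ) :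
    freqResp (shift k u) w = Complex.exp (Complex.I * w * k) • freqResp u w := by
  induction u using Finsupp.induction_linear with
  | zero => simp only [map_zero, Pi.zero_apply, smul_zero]
  | add u v hu hv => simp only [map_add, Pi.add_apply, hu, hv, smul_add]
  | single p r =>
    have hexp : Complex.exp (Complex.I * w * (p.1 + k : ℤ)) =
        Complex.exp (Complex.I * w * k) * Complex.exp (Complex.I * w * p.1) := by
      rw [← Complex.exp_add]
      push_cast
      ring_nf
    rw [shift_single, freqResp, Finsupp.linearCombination_single, Finsupp.linearCombination_single,
      Pi.smul_apply, Pi.smul_apply, smul_comm, coordResp, coordResp, hexp, ← smul_eq_mul,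
      Pi.single_smul]

/-- The filter with response `ω ↦ conj(û(ω)_a) v̂(ω)`: the filter `v` followed by the time reversal
of the coordinate `a` of the filter `u`. It is linear in `u`. -/
def adjointFilter (a : ι) (v : ℤ × ι →₀ ℝ) : (ℤ × ι →₀ ℝ) →ₗ[ℝ] (ℤ × ι →₀ ℝ) :=
  Finsupp.linearCombination ℝ fun p => if p.2 = a then shift (-p.1) v else 0

theorem freqResp_adjointFilter (a : ι) (v u : ℤ × ι →₀ ℝ) (w : ℝ) :
    freqResp (adjointFilter a v u) w = conj (freqResp u w a) • freqResp v w := by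
  induction u using Finsupp.induction_linear with
  | zero => simp only [map_zero, Pi.zero_apply, zero_smul]
  | add u u' hu hu' => simp only [map_add, Pi.add_apply, hu, hu', add_smul]
  | single p r =>
    rw [adjointFilter, Finsupp.linearCombination_single, map_smul, Pi.smul_apply, freqResp,
      Finsupp.linearCombination_single, ← freqResp, Pi.smul_apply, Pi.smul_apply, coordResp,
      Pi.single_apply]
    obtain rfl | ha := eq_or_ne p.2 a
    · rw [if_pos rfl, if_pos rfl, freqResp_shift, Complex.real_smul, map_mul, Complex.conj_ofReal,
        ← Complex.exp_conj, mul_smul, Complex.coe_smul]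
      simp
    · simp [ha, ha.symm]

/-- A bilinear form of two filters which does not change when both are shifted in time. -/
def IsShiftInvariant (ρ : (ℤ × ι →₀ ℝ) →ₗ[ℝ] (ℤ × ι →₀ ℝ) →ₗ[ℝ] ℝ) : Prop :=
  ∀ k u v, ρ (shift k u) (shift k v) = ρ u v

theorem IsShiftInvariant.apply_eq_sum_adjointFilter [Fintype ι]
    {ρ : (ℤ × ι →₀ ℝ) →ₗ[ℝ] (ℤ × ι →₀ ℝ) →ₗ[ℝ] ℝ} (hρ : IsShiftInvariant ρ)
    (u v : ℤ × ι →₀ ℝ) :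
    ρ u v = ∑ a, ρ (Finsupp.single (0, a) 1) (adjointFilter a v u) := by
  induction u using Finsupp.induction_linear with
  | zero => simp only [map_zero, LinearMap.zero_apply, Finset.sum_const_zero]
  | add u u' hu hu' => simp only [map_add, LinearMap.add_apply, hu, hu', Finset.sum_add_distrib]
  | single p r =>
    have hp : Finsupp.single p r = r • Finsupp.single p (1 : ℝ) := by
      rw [Finsupp.smul_single, smul_eq_mul, mul_one]
    simp only [adjointFilter, Finsupp.linearCombination_single, map_smul]
    rw [← Finset.smul_sum, hp, map_smul, LinearMap.smul_apply, Finset.sum_eq_single p.2,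
      if_pos rfl, ← hρ (-p.1) (Finsupp.single p 1), shift_single, add_neg_cancel]
    · exact fun b _ hb => by rw [if_neg hb.symm, map_zero]
    · exact fun h => (h (Finset.mem_univ _)).elim

end ShiftsAndAdjoints

section HilbertProcesses

variable {ι : Type*} {H : Type*} [NormedAddCommGroup H] [InnerProductSpace ℝ H]

/-- The output `∑ u(k, a) ξ_{k,a}` of a finitely supported filter. -/
def output (ξ : ℤ × ι → H) : (ℤ × ι →₀ ℝ) →ₗ[ℝ] H := Finsupp.linearCombination ℝ ξ

theorem output_single_one (ξ : ℤ × ι → H) (p : ℤ × ι) : output ξ (Finsupp.single p 1) = ξ p := by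
  rw [output, Finsupp.linearCombination_single, one_smul]

theorem output_mem_closure_range {ξ η : ℤ × ι → H}
    (hη : ∀ p, η p ∈ closure (Set.range (output ξ))) (u : ℤ × ι →₀ ℝ) :
    output η u ∈ closure (Set.range (output ξ)) :=
  let K := (LinearMap.range (output ξ)).topologicalClosure
  K.finsuppSum_mem _ _ _ fun p _ => K.smul_mem _ (hη p)

variable [Fintype ι] [DecidableEq ι]

/-- A family of vectors of a Hilbert space whose Gram matrix has the continuous spectral
density `Φ`. -/
structure HasSpectrum (ξ : ℤ × ι → H) (Φ : ℝ → Matrix ι ι ℂ) : Prop where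
  continuous : Continuous Φ
  inner_eq : ∀ p q, inner ℝ (ξ p) (ξ q) = specForm Φ (coordResp p) (coordResp q)

/-- The vector `h` is the output of an idealized filter with response `f` applied to `ξ`: it is
a limit of outputs of finitely supported filters whose responses approximate `f`. -/
def HasResponse (ξ : ℤ × ι → H) (f : ℝ → ι → ℂ) (h : H) : Prop :=
  ∃ u : ℕ → ℤ × ι →₀ ℝ, BddTendsto (fun n => freqResp (u n)) atTop f ∧
    Tendsto (fun n => output ξ (u n)) atTop (𝓝 h)

variable {ξ η : ℤ × ι → H} {Φ Ψ : ℝ → Matrix ι ι ℂ}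

theorem hasResponse_coordResp (ξ : ℤ × ι → H) (p : ℤ × ι) :
    HasResponse ξ (coordResp p) (ξ p) := by
  refine ⟨fun _ => Finsupp.single p 1, ?_, ?_⟩
  · simp only [freqResp_single_one]
    exact ⟨(isRealVec_coordResp p).exists_bound.imp fun _ h _ => h, fun _ => tendsto_const_nhds⟩
  · simp only [output_single_one]
    exact tendsto_const_nhds

theorem HasResponse.mem_closure_range {f : ℝ → ι → ℂ} {h : H} (hf : HasResponse ξ f h) :
    h ∈ closure (Set.range (output ξ)) :=
  let ⟨_, _, hu⟩ := hf
  mem_closure_of_tendsto hu (.of_forall fun _ => Set.mem_range_self _)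

namespace HasSpectrum

theorem inner_output (hξ : HasSpectrum ξ Φ) (u v : ℤ × ι →₀ ℝ) :
    inner ℝ (output ξ u) (output ξ v) = specForm Φ (freqResp u) (freqResp v) := by
  rw [specForm_freqResp_left hξ.continuous (isRealVec_freqResp v).continuous, output,
    Finsupp.linearCombination_apply, Finsupp.sum_inner]
  refine Finsupp.sum_congr fun p _ => ?_
  simp only [real_inner_smul_left, Finsupp.linearCombination_apply, Finsupp.inner_sum,
    real_inner_smul_right, hξ.inner_eq, Finsupp.mul_sum, mul_left_comm (u p),
    specForm_freqResp_right hξ.continuous (isRealVec_coordResp p).continuous]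

theorem norm_sq_output (hξ : HasSpectrum ξ Φ) (u : ℤ × ι →₀ ℝ) :
    ‖output ξ u‖ ^ 2 = specForm Φ (freqResp u) (freqResp u) := by
  rw [← hξ.inner_output, real_inner_self_eq_norm_sq]

theorem tendsto_inner_output {κ : Type*} {l : Filter κ} [l.IsCountablyGenerated]
    (hξ : HasSpectrum ξ Φ) {u v : κ → ℤ × ι →₀ ℝ} {f g : ℝ → ι → ℂ}
    (hu : BddTendsto (fun i => freqResp (u i)) l f)
    (hv : BddTendsto (fun i => freqResp (v i)) l g) :
    Tendsto (fun i => inner ℝ (output ξ (u i)) (output ξ (v i))) l (𝓝 (specForm Φ f g)) := by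
  simp only [hξ.inner_output]
  exact tendsto_specForm hξ.continuous (fun i => (isRealVec_freqResp (u i)).continuous)
    (fun i => (isRealVec_freqResp (v i)).continuous) hu hv

theorem tendsto_output_zero {κ : Type*} {l : Filter κ} [l.IsCountablyGenerated]
    (hξ : HasSpectrum ξ Φ) {u : κ → ℤ × ι →₀ ℝ}
    (hu : BddTendsto (fun i => freqResp (u i)) l 0) :
    Tendsto (fun i => ‖output ξ (u i)‖) l (𝓝 0) := by
  have h := (hξ.tendsto_inner_output hu hu).sqrt
  have hzero : specForm Φ (0 : ℝ → ι → ℂ) 0 = 0 := by simp [specForm]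
  simpa only [hzero, Real.sqrt_zero, real_inner_self_eq_norm_sq, Real.sqrt_sq (norm_nonneg _)]
    using h

theorem exists_hasResponse [CompleteSpace H] (hξ : HasSpectrum ξ Φ) {f : ℝ → ι → ℂ}
    (hf : IsRealVec f) : ∃ h, HasResponse ξ f h := by
  obtain ⟨u, hu⟩ := hf.exists_bddTendsto
  suffices hc : CauchySeq fun n => output ξ (u n) from
    (cauchySeq_tendsto_of_complete hc).imp fun h hh => ⟨u, hu, hh⟩
  have hdiff : BddTendsto (fun n : ℕ × ℕ => freqResp (u n.1 - u n.2)) atTop 0 := by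
    rw [← prod_atTop_atTop_eq]
    simpa only [map_sub, sub_self] using (hu.comp tendsto_fst).sub (hu.comp tendsto_snd)
  refine cauchySeq_iff_tendsto_dist_atTop_0.2 ((hξ.tendsto_output_zero hdiff).congr fun n => ?_)
  rw [map_sub, dist_eq_norm]

theorem inner_eq_specForm (hξ : HasSpectrum ξ Φ) {f g : ℝ → ι → ℂ} {h h' : H}
    (hf : HasResponse ξ f h) (hg : HasResponse ξ g h') : inner ℝ h h' = specForm Φ f g := by
  obtain ⟨u, hu, hh⟩ := hf
  obtain ⟨v, hv, hh'⟩ := hg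
  exact tendsto_nhds_unique (hh.inner hh') (hξ.tendsto_inner_output hu hv)

theorem sum_norm_sq (hξ : HasSpectrum ξ Φ) (k : ℤ) : ∑ a, ‖ξ (k, a)‖ ^ 2 = meanTrace Φ := by
  rw [← sum_specForm_coordResp hξ.continuous k]
  exact Finset.sum_congr rfl fun a _ => by rw [← hξ.inner_eq, real_inner_self_eq_norm_sq]

theorem norm_output_shift (hξ : HasSpectrum ξ Φ) (k : ℤ) (u : ℤ × ι →₀ ℝ) :
    ‖output ξ (shift k u)‖ = ‖output ξ u‖ := by
  rw [← sq_eq_sq₀ (norm_nonneg _) (norm_nonneg _), hξ.norm_sq_output, hξ.norm_sq_output,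
    specForm, specForm]
  congr! 3 with w
  rw [freqResp_shift, star_smul, mulVec_smul, smul_dotProduct, dotProduct_smul, smul_smul,
    Complex.star_def, conj_exp_mul_exp, one_smul]

end HasSpectrum

end HilbertProcesses

section CesaroMeans

/-- The Cesàro mean of the first `n + 1` terms of a sequence. -/
def cesaro {E : Type*} [AddCommGroup E] [Module ℝ E] (f : ℕ → E) (n : ℕ) : E :=
  ((n : ℝ) + 1)⁻¹ • ∑ k ∈ Finset.range (n + 1), f k

theorem map_cesaro {E F : Type*} [AddCommGroup E] [Module ℝ E] [AddCommGroup F] [Module ℝ F]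
    (φ : E →ₗ[ℝ] F) (f : ℕ → E) (n : ℕ) : φ (cesaro f n) = cesaro (fun k => φ (f k)) n := by
  rw [cesaro, cesaro, map_smul, map_sum]

theorem cesaro_const {E : Type*} [AddCommGroup E] [Module ℝ E] (x : E) (n : ℕ) :
    cesaro (fun _ => x) n = x := by
  rw [cesaro, Finset.sum_const, Finset.card_range, ← Nat.cast_smul_eq_nsmul ℝ, Nat.cast_succ,
    inv_smul_smul₀ n.cast_add_one_ne_zero]

theorem cesaro_sub {E : Type*} [AddCommGroup E] [Module ℝ E] (f g : ℕ → E) (n : ℕ) :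
    cesaro (fun k => f k - g k) n = cesaro f n - cesaro g n := by
  rw [cesaro, Finset.sum_sub_distrib, smul_sub, cesaro, cesaro]

variable {E : Type*} [NormedAddCommGroup E] [NormedSpace ℝ E] {f : ℕ → E} {C : ℝ}

theorem norm_cesaro_le (hf : ∀ k, ‖f k‖ ≤ C) (n : ℕ) : ‖cesaro f n‖ ≤ C := by
  rw [cesaro, norm_smul, norm_inv, Real.norm_of_nonneg (by positivity),
    inv_mul_le_iff₀ (by positivity)]
  exact (norm_sum_le_of_le _ fun k _ => hf k).trans_eq (by simp)

theorem tendsto_cesaro_succ_sub (hf : ∀ k, ‖f k‖ ≤ C) :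
    Tendsto (fun n => cesaro (fun k => f (k + 1)) n - cesaro f n) atTop (𝓝 0) := by
  have htel : ∀ n, cesaro (fun k => f (k + 1)) n - cesaro f n =
      ((n : ℝ) + 1)⁻¹ • (f (n + 1) - f 0) := fun n => by
    rw [cesaro, cesaro, ← smul_sub, ← Finset.sum_sub_distrib, Finset.sum_range_sub]
  have hlim : Tendsto (fun n : ℕ => 1 / ((n : ℝ) + 1) * (C + C)) atTop (𝓝 0) := by
    simpa only [zero_mul] using tendsto_one_div_add_atTop_nhds_zero_nat.mul_const (C + C)
  refine squeeze_zero_norm (fun n => ?_) hlim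
  rw [htel, norm_smul, norm_inv, Real.norm_of_nonneg (by positivity), one_div]
  gcongr
  exact norm_sub_le_of_le (hf _) (hf _)

end CesaroMeans

theorem exists_bilin_tendsto_ultrafilter {κ E F : Type*} [AddCommGroup E] [Module ℝ E]
    [AddCommGroup F] [Module ℝ F] (𝒰 : Ultrafilter κ) {B : κ → E →ₗ[ℝ] F →ₗ[ℝ] ℝ}
    {C : E → F → ℝ} (hB : ∀ i u v, ‖B i u v‖ ≤ C u v) :
    ∃ ρ : E →ₗ[ℝ] F →ₗ[ℝ] ℝ, (∀ u v, Tendsto (fun i => B i u v) 𝒰 (𝓝 (ρ u v))) := by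
  have hlim : ∀ u v, ∃ L, Tendsto (fun i => B i u v) 𝒰 (𝓝 L) := fun u v =>
    let ⟨L, _, hL⟩ := (isCompact_closedBall (0 : ℝ) (C u v)).ultrafilter_le_nhds
      (𝒰.map fun i => B i u v)
      (tendsto_principal.2 (.of_forall fun i => mem_closedBall_zero_iff.2 (hB i u v)))
    ⟨L, hL⟩
  choose ρ hρ using hlim
  refine ⟨LinearMap.mk₂ ℝ ρ (fun u u' v => ?_) (fun r u v => ?_) (fun u v v' => ?_)
    (fun r u v => ?_), hρ⟩ <;> refine tendsto_nhds_unique (hρ _ _) ?_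
  · simpa only [map_add, LinearMap.add_apply] using (hρ u v).add (hρ u' v)
  · simpa only [map_smul, LinearMap.smul_apply] using (hρ u v).const_smul r
  · simpa only [map_add] using (hρ u v).add (hρ u v')
  · simpa only [map_smul] using (hρ u v).const_smul r

section CrossCorrelations

variable {ι : Type*} {H : Type*} [NormedAddCommGroup H] [InnerProductSpace ℝ H]

/-- The cross-correlation at time `k` of the outputs of two families, as a bilinear form in the
two filters. -/
def crossCorr (ξ η : ℤ × ι → H) (k : ℕ) : (ℤ × ι →₀ ℝ) →ₗ[ℝ] (ℤ × ι →₀ ℝ) →ₗ[ℝ] ℝ :=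
  (innerₗ H).compl₁₂ (output ξ ∘ₗ shift k) (output η ∘ₗ shift k)

theorem cesaro_crossCorr_apply (ξ η : ℤ × ι → H) (n : ℕ) (u v : ℤ × ι →₀ ℝ) :
    cesaro (crossCorr ξ η) n u v =
      cesaro (fun k : ℕ => inner ℝ (output ξ (shift k u)) (output η (shift k v))) n := by
  simp only [cesaro, LinearMap.smul_apply, LinearMap.sum_apply]
  rfl

theorem cesaro_sum_inner [Fintype ι] (ξ η : ℤ × ι → H) (n : ℕ) :
    cesaro (fun k : ℕ => ∑ a, inner ℝ (ξ (k, a)) (η (k, a))) n =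
      ∑ a, cesaro (crossCorr ξ η) n (Finsupp.single (0, a) 1) (Finsupp.single (0, a) 1) := by
  simp only [cesaro_crossCorr_apply, shift_single, zero_add, output_single_one]
  simp only [cesaro, ← Finset.smul_sum]
  rw [Finset.sum_comm]

theorem isShiftInvariant_of_shift_one {ρ : (ℤ × ι →₀ ℝ) →ₗ[ℝ] (ℤ × ι →₀ ℝ) →ₗ[ℝ] ℝ}
    (hρ : ∀ u v, ρ (shift 1 u) (shift 1 v) = ρ u v) : IsShiftInvariant ρ := by
  intro k u v
  induction k with
  | zero => rw [shift_zero, shift_zero]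
  | succ k ih => rw [← shift_shift, ← shift_shift, hρ, ih]
  | pred k ih => rw [← ih, ← hρ (shift (-(k : ℤ) - 1) u), shift_shift, shift_shift, sub_add_cancel]

variable [Fintype ι] [DecidableEq ι] {ξ η : ℤ × ι → H} {Φ Ψ : ℝ → Matrix ι ι ℂ}

theorem HasSpectrum.exists_crossForm (hξ : HasSpectrum ξ Φ) (hη : HasSpectrum η Ψ) :
    ∃ ρ : (ℤ × ι →₀ ℝ) →ₗ[ℝ] (ℤ × ι →₀ ℝ) →ₗ[ℝ] ℝ,
      (∀ u v, Tendsto (fun n => cesaro (crossCorr ξ η) n u v) (hyperfilter ℕ) (𝓝 (ρ u v))) ∧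
      (∀ u v, ‖ρ u v‖ ≤ ‖output ξ u‖ * ‖output η v‖) ∧ IsShiftInvariant ρ := by
  have hbound : ∀ (u v : ℤ × ι →₀ ℝ) (k : ℕ),
      ‖inner ℝ (output ξ (shift k u)) (output η (shift k v))‖ ≤ ‖output ξ u‖ * ‖output η v‖ :=
    fun u v k => (norm_inner_le_norm _ _).trans_eq <| by
      rw [hξ.norm_output_shift, hη.norm_output_shift]
  have hcesaro : ∀ n u v, ‖cesaro (crossCorr ξ η) n u v‖ ≤ ‖output ξ u‖ * ‖output η v‖ :=
    fun n u v => cesaro_crossCorr_apply ξ η n u v ▸ norm_cesaro_le (hbound u v) n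
  obtain ⟨ρ, hρ⟩ := exists_bilin_tendsto_ultrafilter (hyperfilter ℕ) hcesaro
  refine ⟨ρ, hρ, fun u v => le_of_tendsto (hρ u v).norm (.of_forall fun n => hcesaro n u v),
    isShiftInvariant_of_shift_one fun u v => sub_eq_zero.1 ?_⟩
  have hsucc := (tendsto_cesaro_succ_sub (hbound u v)).mono_left Nat.hyperfilter_le_atTop
  refine tendsto_nhds_unique ((hρ (shift 1 u) (shift 1 v)).sub (hρ u v)) (hsucc.congr fun n => ?_)
  simp only [cesaro_crossCorr_apply, shift_shift, Nat.cast_succ, add_comm]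

theorem HasSpectrum.tendsto_sum_norm_sq (hξ : HasSpectrum ξ Φ) {F : ℝ → Matrix ι ι ℂ}
    (hF : Continuous F) {u : ι → ℕ → ℤ × ι →₀ ℝ}
    (hu : ∀ c, BddTendsto (fun n => freqResp (u c n)) atTop fun w => F w *ᵥ coordResp (0, c) w) :
    Tendsto (fun n => ∑ c, ‖output ξ (u c n)‖ ^ 2) atTop
      (𝓝 (meanTrace fun w => (F w)ᴴ * Φ w * F w)) := by
  rw [← sum_specForm_coordResp
    ((hF.matrix_conjTranspose.matrix_mul hξ.continuous).matrix_mul hF) 0]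
  refine tendsto_finsetSum _ fun c _ => ?_
  simpa only [specForm_mulVec, real_inner_self_eq_norm_sq] using
    hξ.tendsto_inner_output (hu c) (hu c)

theorem sum_conj_mulVec_smul_mulVec {F G : Matrix ι ι ℂ} (hGF : G * Fᴴ = 1) (a : ι) (w : ℝ) :
    ∑ c, conj ((F *ᵥ coordResp (0, c) w) a) • (G *ᵥ coordResp (0, c) w) = coordResp (0, a) w := by
  have hsingle : ∀ c : ι, coordResp (0, c) w = Pi.single c 1 := fun c => by simp [coordResp]
  ext b
  simp only [hsingle, mulVec_single_one, Finset.sum_apply, Pi.smul_apply, col_apply, smul_eq_mul]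
  rw [Pi.single_apply, ← Matrix.one_apply, ← hGF, Matrix.mul_apply]
  exact Finset.sum_congr rfl fun c _ => mul_comm _ _

theorem bddTendsto_sum_adjointFilter {F G : ℝ → Matrix ι ι ℂ} (hGF : ∀ w, G w * (F w)ᴴ = 1)
    {u v : ι → ℕ → ℤ × ι →₀ ℝ}
    (hu : ∀ c, BddTendsto (fun n => freqResp (u c n)) atTop fun w => F w *ᵥ coordResp (0, c) w)
    (hv : ∀ c, BddTendsto (fun n => freqResp (v c n)) atTop fun w => G w *ᵥ coordResp (0, c) w)
    (a : ι) :
    BddTendsto (fun n => freqResp (∑ c, adjointFilter a (v c n) (u c n))) atTop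
      (coordResp (0, a)) := by
  convert BddTendsto.sum Finset.univ fun c => (hu c).conj_apply_smul (hv c) a using 1
  · ext n w b
    simp only [map_sum, Finset.sum_apply, freqResp_adjointFilter]
  · ext w : 1
    rw [← sum_conj_mulVec_smul_mulVec (hGF w), Finset.sum_apply]

namespace IsShiftInvariant

variable {ρ : (ℤ × ι →₀ ℝ) →ₗ[ℝ] (ℤ × ι →₀ ℝ) →ₗ[ℝ] ℝ} {F G : ℝ → Matrix ι ι ℂ}

theorem tendsto_sum (hρ : IsShiftInvariant ρ) (hη : HasSpectrum η Ψ)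
    (hbound : ∀ u v, ‖ρ u v‖ ≤ ‖output ξ u‖ * ‖output η v‖)
    (hGF : ∀ w, G w * (F w)ᴴ = 1) {u v : ι → ℕ → ℤ × ι →₀ ℝ}
    (hu : ∀ c, BddTendsto (fun n => freqResp (u c n)) atTop fun w => F w *ᵥ coordResp (0, c) w)
    (hv : ∀ c, BddTendsto (fun n => freqResp (v c n)) atTop fun w => G w *ᵥ coordResp (0, c) w) :
    Tendsto (fun n => ∑ c, ρ (u c n) (v c n)) atTop
      (𝓝 (∑ a, ρ (Finsupp.single (0, a) 1) (Finsupp.single (0, a) 1))) := by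
  have hswap : ∀ n, ∑ c, ρ (u c n) (v c n) =
      ∑ a, ρ (Finsupp.single (0, a) 1) (∑ c, adjointFilter a (v c n) (u c n)) := fun n => by
    simp only [map_sum, hρ.apply_eq_sum_adjointFilter (u _ n)]
    exact Finset.sum_comm
  simp only [hswap]
  refine tendsto_finsetSum _ fun a _ => tendsto_sub_nhds_zero_iff.1 ?_
  have hzero : BddTendsto (fun n => freqResp
      (∑ c, adjointFilter a (v c n) (u c n) - Finsupp.single (0, a) 1)) atTop 0 := by
    have hconst : BddTendsto (fun _ : ℕ => coordResp (0, a)) atTop (coordResp (0, a)) :=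
      ⟨(isRealVec_coordResp (0, a)).exists_bound.imp fun _ h _ => h, fun _ => tendsto_const_nhds⟩
    simpa only [map_sub, sub_self, freqResp_single_one] using
      (bddTendsto_sum_adjointFilter hGF hu hv a).sub hconst
  have hlim := (hη.tendsto_output_zero hzero).const_mul ‖output ξ (Finsupp.single (0, a) 1)‖
  rw [mul_zero] at hlim
  exact squeeze_zero_norm (fun n => map_sub (ρ _) _ (Finsupp.single (0, a) 1) ▸ hbound _ _) hlim

theorem two_mul_sum_le (hρ : IsShiftInvariant ρ) (hξ : HasSpectrum ξ Φ) (hη : HasSpectrum η Ψ)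
    (hbound : ∀ u v, ‖ρ u v‖ ≤ ‖output ξ u‖ * ‖output η v‖)
    (hF : IsRealSymbol F) (hG : IsRealSymbol G) (hGF : ∀ w, G w * (F w)ᴴ = 1) :
    2 * ∑ a, ρ (Finsupp.single (0, a) 1) (Finsupp.single (0, a) 1) ≤
      meanTrace (fun w => (F w)ᴴ * Φ w * F w) + meanTrace fun w => (G w)ᴴ * Ψ w * G w := by
  choose u hu using fun c => (IsRealVec.mulVec hF (isRealVec_coordResp (0, c))).exists_bddTendsto
  choose v hv using fun c => (IsRealVec.mulVec hG (isRealVec_coordResp (0, c))).exists_bddTendsto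
  refine le_of_tendsto_of_tendsto' ((hρ.tendsto_sum hη hbound hGF hu hv).const_mul 2)
    ((hξ.tendsto_sum_norm_sq hF.continuous hu).add (hη.tendsto_sum_norm_sq hG.continuous hv))
    fun n => ?_
  rw [Finset.mul_sum, ← Finset.sum_add_distrib]
  refine Finset.sum_le_sum fun c _ => ?_
  calc 2 * ρ (u c n) (v c n)
      ≤ 2 * (‖output ξ (u c n)‖ * ‖output η (v c n)‖) := by
        gcongr
        exact (Real.le_norm_self _).trans (hbound _ _)
    _ ≤ ‖output ξ (u c n)‖ ^ 2 + ‖output η (v c n)‖ ^ 2 := by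
        rw [← mul_assoc]
        exact two_mul_le_add_sq _ _

theorem sum_le_meanTrace_fidelity (hρ : IsShiftInvariant ρ) (hξ : HasSpectrum ξ Φ)
    (hη : HasSpectrum η Ψ) (hbound : ∀ u v, ‖ρ u v‖ ≤ ‖output ξ u‖ * ‖output η v‖)
    (hΦ : IsRealSymbol Φ) (hΨ : IsRealSymbol Ψ) (hΦ0 : ∀ w, (Φ w).PosDef)
    (hΨ0 : ∀ w, (Ψ w).PosDef) :
    ∑ a, ρ (Finsupp.single (0, a) 1) (Finsupp.single (0, a) 1) ≤
      meanTrace fun w => fidelity (Φ w) (Ψ w) := by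
  have hT0 : ∀ w, (transportMap (Φ w) (Ψ w)).PosDef := fun w =>
    posDef_transportMap (hΦ0 w) (hΨ0 w)
  have hF : IsRealSymbol fun w => CFC.sqrt (transportMap (Φ w) (Ψ w)) :=
    (hΦ.transportMap hΨ hΦ0 hΨ0).sqrt fun w => (hT0 w).posSemidef
  have hF0 : ∀ w, IsUnit (CFC.sqrt (transportMap (Φ w) (Ψ w))) := fun w =>
    (posDef_sqrt (hT0 w)).isUnit
  have hle := hρ.two_mul_sum_le hξ hη hbound hF (hF.inv hF0) fun w => by
    rw [conjTranspose_sqrt, nonsing_inv_mul _ ((isUnit_iff_isUnit_det _).1 (hF0 w))]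
  simp only [meanTrace, trace_conj_sqrt_transportMap (hΦ0 _) (hΨ0 _),
    trace_conj_inv_sqrt_transportMap (hΦ0 _) (hΨ0 _)] at hle ⊢
  linarith

end IsShiftInvariant

theorem HasSpectrum.sum_norm_sub_sq (hξ : HasSpectrum ξ Φ) (hη : HasSpectrum η Ψ) (k : ℤ) :
    ∑ a, ‖ξ (k, a) - η (k, a)‖ ^ 2 =
      meanTrace Φ + meanTrace Ψ - 2 * ∑ a, inner ℝ (ξ (k, a)) (η (k, a)) := by
  simp only [norm_sub_sq_real, Finset.sum_add_distrib, Finset.sum_sub_distrib, ← Finset.mul_sum,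
    hξ.sum_norm_sq, hη.sum_norm_sq]
  ring

theorem HasSpectrum.meanTrace_le_of_cesaro_le (hξ : HasSpectrum ξ Φ) (hη : HasSpectrum η Ψ)
    (hΦ : IsRealSymbol Φ) (hΨ : IsRealSymbol Ψ) (hΦ0 : ∀ w, (Φ w).PosDef)
    (hΨ0 : ∀ w, (Ψ w).PosDef) {C : ℝ}
    (hC : ∀ᶠ n in atTop, cesaro (fun k : ℕ => ∑ a, ‖ξ (k, a) - η (k, a)‖ ^ 2) n ≤ C) :
    meanTrace Φ + meanTrace Ψ - 2 * meanTrace (fun w => fidelity (Φ w) (Ψ w)) ≤ C := by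
  obtain ⟨ρ, hρ, hbound, hinv⟩ := hξ.exists_crossForm hη
  set e : ι → ℤ × ι →₀ ℝ := fun a => Finsupp.single (0, a) 1
  have hlim : Tendsto (cesaro fun k : ℕ => ∑ a, ‖ξ (k, a) - η (k, a)‖ ^ 2) (hyperfilter ℕ)
      (𝓝 (meanTrace Φ + meanTrace Ψ - 2 * ∑ a, ρ (e a) (e a))) := by
    have hsum := tendsto_finsetSum Finset.univ fun a _ => hρ (e a) (e a)
    refine ((hsum.const_mul 2).const_sub _).congr fun n => ?_
    rw [← cesaro_sum_inner, ← cesaro_const (meanTrace Φ + meanTrace Ψ) n, ← smul_eq_mul,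
      ← LinearMap.lsmul_apply, map_cesaro, ← cesaro_sub]
    simp only [hξ.sum_norm_sub_sq hη, LinearMap.lsmul_apply, smul_eq_mul]
  have hD := le_of_tendsto hlim (hC.filter_mono Nat.hyperfilter_le_atTop)
  have hle := hinv.sum_le_meanTrace_fidelity hξ hη hbound hΦ hΨ hΦ0 hΨ0
  linarith

end CrossCorrelations

section OptimalFilter

variable {ι : Type*} [Fintype ι] [DecidableEq ι] {Φ Ψ : ℝ → Matrix ι ι ℂ}
  {H : Type*} [NormedAddCommGroup H] [InnerProductSpace ℝ H] [CompleteSpace H] {ξ : ℤ × ι → H}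

theorem HasSpectrum.exists_filtered {A : ℝ → Matrix ι ι ℂ} (hξ : HasSpectrum ξ Φ)
    (hA : IsRealSymbol A) :
    ∃ η : ℤ × ι → H, HasSpectrum η (fun w => (A w)ᴴ * Φ w * A w) ∧
      (∀ p, η p ∈ closure (Set.range (output ξ))) ∧
      ∀ k, ∑ a, inner ℝ (ξ (k, a)) (η (k, a)) = meanTrace fun w => Φ w * A w := by
  choose η hη using fun p : ℤ × ι => hξ.exists_hasResponse ((isRealVec_coordResp p).mulVec hA)
  refine ⟨η, ⟨?_, fun p q => ?_⟩, fun p => (hη p).mem_closure_range, fun k => ?_⟩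
  · exact (hA.continuous.matrix_conjTranspose.matrix_mul hξ.continuous).matrix_mul hA.continuous
  · rw [hξ.inner_eq_specForm (hη p) (hη q), specForm_mulVec]
  · rw [← sum_specForm_coordResp (hξ.continuous.matrix_mul hA.continuous) k]
    refine Finset.sum_congr rfl fun a _ => ?_
    rw [hξ.inner_eq_specForm (hasResponse_coordResp ξ (k, a)) (hη (k, a))]
    simp only [specForm, mulVec_mulVec]

theorem HasSpectrum.exists_optimal (hξ : HasSpectrum ξ Φ) (hΦ : IsRealSymbol Φ)
    (hΨ : IsRealSymbol Ψ) (hΦ0 : ∀ w, (Φ w).PosDef) (hΨ0 : ∀ w, (Ψ w).PosDef) :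
    ∃ η : ℤ × ι → H, HasSpectrum η Ψ ∧ (∀ p, η p ∈ closure (Set.range (output ξ))) ∧
      ∀ k, ∑ a, ‖ξ (k, a) - η (k, a)‖ ^ 2 =
        meanTrace Φ + meanTrace Ψ - 2 * meanTrace (fun w => fidelity (Φ w) (Ψ w)) := by
  obtain ⟨η, hη, hmem, hcross⟩ := hξ.exists_filtered (hΦ.transportMap hΨ hΦ0 hΨ0)
  simp only [(posDef_transportMap (hΦ0 _) (hΨ0 _)).isHermitian.eq,
    transportMap_mul_mul_transportMap (hΦ0 _) (hΨ0 _)] at hη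
  refine ⟨η, hη, hmem, fun k => ?_⟩
  rw [hξ.sum_norm_sub_sq hη, hcross]
  simp only [meanTrace, trace_mul_transportMap (hΦ0 _)]

end OptimalFilter

section BuresDistance

variable {m : ℕ} {Φ Ψ : ℝ → Matrix (Fin m) (Fin m) ℂ}

theorem continuous_buresMatrix (hΦ : IsRealSymbol Φ) (hΨ : IsRealSymbol Ψ)
    (hΦ0 : ∀ w, (Φ w).PosDef) (hΨ0 : ∀ w, (Ψ w).PosDef) :
    Continuous fun w => buresMatrix (Φ w) (Ψ w) :=
  (hΦ.continuous.add hΨ.continuous).sub ((hΦ.fidelity hΨ hΦ0 hΨ0).continuous.const_smul (2 : ℂ))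

theorem meanTrace_buresMatrix (hΦ : IsRealSymbol Φ) (hΨ : IsRealSymbol Ψ)
    (hΦ0 : ∀ w, (Φ w).PosDef) (hΨ0 : ∀ w, (Ψ w).PosDef) :
    meanTrace (fun w => buresMatrix (Φ w) (Ψ w)) =
      meanTrace Φ + meanTrace Ψ - 2 * meanTrace (fun w => fidelity (Φ w) (Ψ w)) := by
  have hint : ∀ {M : ℝ → Matrix (Fin m) (Fin m) ℂ}, Continuous M →
      IntervalIntegrable (fun w => (M w).trace.re) volume 0 (2 * Real.pi) := fun hM =>
    (Complex.continuous_re.comp hM.matrix_trace).intervalIntegrable _ _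
  have htrace : ∀ w, (buresMatrix (Φ w) (Ψ w)).trace.re =
      (Φ w).trace.re + (Ψ w).trace.re - 2 * (fidelity (Φ w) (Ψ w)).trace.re := fun w => by
    simp [buresMatrix, fidelity]
  simp only [meanTrace, htrace]
  rw [intervalIntegral.integral_sub ((hint hΦ.continuous).add (hint hΨ.continuous))
      ((hint (hΦ.fidelity hΨ hΦ0 hΨ0).continuous).const_mul 2),
    intervalIntegral.integral_add (hint hΦ.continuous) (hint hΨ.continuous),
    intervalIntegral.integral_const_mul]
  ring

end BuresDistance

section Elliptical

variable {ι : Type*} [Fintype ι]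

theorem map_withDensity_comp {α β : Type*} [MeasurableSpace α] [MeasurableSpace β]
    (μ : Measure α) {e : α → β} (he : Measurable e) {h : β → ℝ≥0∞} (hh : Measurable h) :
    (μ.withDensity fun a => h (e a)).map e = (μ.map e).withDensity h := by
  ext s hs
  rw [Measure.map_apply he hs, withDensity_apply _ (he hs), withDensity_apply _ hs,
    setLIntegral_map hs hh he]

/-- The measure with density `g(‖z‖²)`. Every elliptical distribution with density generator `g` is
a linear image of it. -/
def sphericalMeasure (ι : Type*) [Fintype ι] (g : ℝ → ℝ≥0) : Measure (EuclideanSpace ℝ ι) :=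
  volume.withDensity fun z => ENNReal.ofReal (g (‖z‖ ^ 2))

theorem sphericalMeasure_map {g : ℝ → ℝ≥0} (hg : Measurable g)
    (U : EuclideanSpace ℝ ι ≃ₗᵢ[ℝ] EuclideanSpace ℝ ι) :
    (sphericalMeasure ι g).map U = sphericalMeasure ι g := by
  have h := map_withDensity_comp (volume : Measure (EuclideanSpace ℝ ι))
    U.continuous.measurable (h := fun z => ENNReal.ofReal (g (‖z‖ ^ 2))) (by fun_prop)
  simpa only [sphericalMeasure, U.measurePreserving.map_eq, U.norm_map] using h

theorem sphericalMeasure_map_inner {g : ℝ → ℝ≥0} (hg : Measurable g)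
    {w w' : EuclideanSpace ℝ ι} (h : ‖w‖ = ‖w'‖) :
    (sphericalMeasure ι g).map (inner ℝ w) = (sphericalMeasure ι g).map (inner ℝ w') := by
  let U := (ℝ ∙ (w - w'))ᗮ.reflection
  have hU : U w = w' := Submodule.reflection_sub h
  rw [← sphericalMeasure_map hg U, ← hU, sphericalMeasure_map hg U]
  conv_rhs => rw [← sphericalMeasure_map hg U]
  rw [Measure.map_map (by fun_prop) U.continuous.measurable]
  congr 1
  exact funext fun z => (U.inner_map_map w z).symm

section ScatterMatrix

variable [DecidableEq ι] {S : Matrix ι ι ℝ}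

theorem sqrt_mulVec_dotProduct_inv_mulVec (hS : S.PosDef) (z : ι → ℝ) :
    (CFC.sqrt S *ᵥ z) ⬝ᵥ S⁻¹ *ᵥ (CFC.sqrt S *ᵥ z) = z ⬝ᵥ z := by
  have hu := (isUnit_iff_isUnit_det _).1 (posDef_sqrt hS).isUnit
  have hinv : CFC.sqrt S * S⁻¹ = (CFC.sqrt S)⁻¹ := by
    conv_rhs => rw [← self_mul_inv_sqrt hS, Matrix.mul_inv_rev, nonsing_inv_nonsing_inv _ hu]
  have hT : (CFC.sqrt S)ᵀ = CFC.sqrt S := by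
    rw [← conjTranspose_eq_transpose_of_trivial, conjTranspose_sqrt]
  rw [dotProduct_comm, dotProduct_mulVec, ← mulVec_transpose, hT, mulVec_mulVec, mulVec_mulVec,
    hinv, nonsing_inv_mul _ hu, one_mulVec]

theorem sqrt_det (hS : S.PosDef) : √S.det = (CFC.sqrt S).det := by
  conv_lhs => rw [← CFC.sqrt_mul_sqrt_self S hS.posSemidef.nonneg, det_mul]
  exact Real.sqrt_mul_self (posDef_sqrt hS).det_pos.le

end ScatterMatrix

namespace IsElliptical

variable [DecidableEq ι] {μ μ' : Measure (EuclideanSpace ℝ ι)} {g : ℝ → ℝ≥0}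

theorem exists_eq_sphericalMeasure_map (h : IsElliptical μ g) :
    ∃ Q : EuclideanSpace ℝ ι →ₗ[ℝ] EuclideanSpace ℝ ι, μ = (sphericalMeasure ι g).map Q := by
  obtain ⟨hg, S, hS, rfl⟩ := h
  let Q : EuclideanSpace ℝ ι →ₗ[ℝ] EuclideanSpace ℝ ι := Matrix.toLpLin 2 2 (CFC.sqrt S)
  have hpos : 0 < (CFC.sqrt S).det := (posDef_sqrt hS).det_pos
  have hQ : LinearMap.det Q = (CFC.sqrt S).det := LinearMap.det_toLpLin 2 _
  let density (v : EuclideanSpace ℝ ι) : ℝ≥0∞ := ENNReal.ofReal (g (v.ofLp ⬝ᵥ S⁻¹ *ᵥ v.ofLp))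
  have hdensity : Measurable density := by
    have hofLp : Continuous fun v : EuclideanSpace ℝ ι => v.ofLp := PiLp.continuous_ofLp 2 _
    have hform : Continuous fun v : EuclideanSpace ℝ ι => v.ofLp ⬝ᵥ S⁻¹ *ᵥ v.ofLp :=
      hofLp.dotProduct (continuous_const.matrix_mulVec hofLp)
    have := hform.measurable
    fun_prop
  have hdensityQ : ∀ z, density (Q z) = ENNReal.ofReal (g (‖z‖ ^ 2)) := fun z => by
    simp only [density, Q, toLpLin_apply, sqrt_mulVec_dotProduct_inv_mulVec hS]
    simp only [EuclideanSpace.real_norm_sq_eq z, dotProduct, ← sq]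
  refine ⟨Q, ?_⟩
  calc (volume.withDensity fun v : EuclideanSpace ℝ ι =>
        ENNReal.ofReal ((√S.det)⁻¹ * g (v.ofLp ⬝ᵥ S⁻¹ *ᵥ v.ofLp)))
      = (volume.map Q).withDensity density := by
        rw [Measure.map_linearMap_addHaar_eq_smul_addHaar _ (hQ ▸ hpos.ne'),
          withDensity_smul_measure, ← withDensity_smul _ hdensity, hQ, sqrt_det hS,
          abs_of_pos (inv_pos.2 hpos)]
        congr 1
        exact funext fun v => ENNReal.ofReal_mul (inv_pos.2 hpos).le
    _ = (sphericalMeasure ι g).map Q := by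
        rw [← map_withDensity_comp _ Q.continuous_of_finiteDimensional.measurable hdensity]
        simp only [hdensityQ, sphericalMeasure]

theorem exists_map_inner_eq (h : IsElliptical μ g) (v : EuclideanSpace ℝ ι) :
    ∃ w, μ.map (inner ℝ v) = (sphericalMeasure ι g).map (inner ℝ w) := by
  obtain ⟨Q, rfl⟩ := h.exists_eq_sphericalMeasure_map
  refine ⟨LinearMap.adjoint Q v, ?_⟩
  rw [Measure.map_map (by fun_prop) Q.continuous_of_finiteDimensional.measurable]
  congr 1
  exact funext fun z => (LinearMap.adjoint_inner_left Q z v).symm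

theorem map_inner_eq (h : IsElliptical μ g) (h' : IsElliptical μ' g)
    {v v' : EuclideanSpace ℝ ι}
    (hv : ∫ r, r ^ 2 ∂μ.map (inner ℝ v) = ∫ r, r ^ 2 ∂μ'.map (inner ℝ v'))
    (hv0 : ∫ r, r ^ 2 ∂μ.map (inner ℝ v) ≠ 0) : μ.map (inner ℝ v) = μ'.map (inner ℝ v') := by
  obtain ⟨w, hw⟩ := h.exists_map_inner_eq v
  obtain ⟨w', hw'⟩ := h'.exists_map_inner_eq v'
  rw [hw] at hv0
  rw [hw, hw'] at hv ⊢
  have hmoment : ∀ a : EuclideanSpace ℝ ι, ∫ r, r ^ 2 ∂(sphericalMeasure ι g).map (inner ℝ a) =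
      ∫ z, inner ℝ a z ^ 2 ∂sphericalMeasure ι g := fun a => by
    rw [integral_map (by fun_prop) (by fun_prop)]
  have hw0 : ‖w‖ ≠ 0 := fun h0 => hv0 (by rw [hmoment]; simp [norm_eq_zero.1 h0])
  have hscale : ‖(‖w'‖ / ‖w‖) • w‖ = ‖w'‖ := by
    rw [norm_smul, norm_div, norm_norm, norm_norm, div_mul_cancel₀ _ hw0]
  have hsq : ∫ r, r ^ 2 ∂(sphericalMeasure ι g).map (inner ℝ w) =
      (‖w'‖ / ‖w‖) ^ 2 * ∫ r, r ^ 2 ∂(sphericalMeasure ι g).map (inner ℝ w) := by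
    conv_lhs => rw [hv, ← sphericalMeasure_map_inner h.1 hscale, hmoment]
    simp only [hmoment, real_inner_smul_left, mul_pow, integral_const_mul]
  have hratio : (‖w'‖ / ‖w‖) ^ 2 = 1 := (mul_eq_right₀ hv0).1 hsq.symm
  rw [pow_eq_one_iff_of_nonneg (by positivity) two_ne_zero, div_eq_one_iff_eq hw0] at hratio
  exact sphericalMeasure_map_inner h.1 hratio.symm

end IsElliptical

end Elliptical

section PathFunctionals

variable {m : ℕ}

/-- The coordinates of a path, as one real family indexed by time and component. -/
def coords (z : ℤ → EuclideanSpace ℝ (Fin m)) (p : ℤ × Fin m) : ℝ := z p.1 p.2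

/-- The part of the coefficient family `u` on the time window `{-N, …, N}`, laid out as a vector to
be paired with `block (-N) (2 * N)`. -/
def windowVec (N : ℕ) (u : ℤ × Fin m →₀ ℝ) : EuclideanSpace ℝ (Fin (2 * N + 1) × Fin m) :=
  WithLp.toLp 2 fun p => u (-(N : ℤ) + (p.1 : ℕ), p.2)

theorem exists_abs_time_le (s : Finset (ℤ × Fin m)) : ∃ N : ℕ, ∀ p ∈ s, |p.1| ≤ N := by
  refine ⟨s.sup fun p => p.1.natAbs, fun p hp => ?_⟩
  rw [Int.abs_eq_natAbs, Nat.cast_le]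
  exact Finset.le_sup (f := fun p : ℤ × Fin m => p.1.natAbs) hp

theorem output_coords_eq_inner {N : ℕ} {u : ℤ × Fin m →₀ ℝ}
    (hu : ∀ p ∈ u.support, |p.1| ≤ N) (z : ℤ → EuclideanSpace ℝ (Fin m)) :
    output (coords z) u = inner ℝ (windowVec N u) (block (-(N : ℤ)) (2 * N) z) := by
  let φ : Fin (2 * N + 1) × Fin m → ℤ × Fin m := fun p => (-(N : ℤ) + (p.1 : ℕ), p.2)
  have hφ : Function.Injective φ := by
    rintro ⟨i, a⟩ ⟨j, b⟩ h
    simp only [φ, Prod.mk.injEq, add_right_inj, Nat.cast_inj] at h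
    exact Prod.ext (Fin.ext h.1) h.2
  have hsupp : u.support ⊆ Finset.univ.image φ := fun p hp => by
    have hp := abs_le.1 (hu p hp)
    refine Finset.mem_image.2 ⟨(⟨(p.1 + N).toNat, by omega⟩, p.2), Finset.mem_univ _, ?_⟩
    refine Prod.ext ?_ rfl
    simp only [φ]
    omega
  rw [output, Finsupp.linearCombination_apply, Finsupp.sum_of_support_subset _ hsupp _ (by simp),
    Finset.sum_image fun _ _ _ _ h => hφ h, PiLp.inner_apply]
  refine Finset.sum_congr rfl fun p _ => ?_
  simp [φ, coords, block, windowVec, mul_comm]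

theorem measurable_coords (p : ℤ × Fin m) :
    Measurable fun z : ℤ → EuclideanSpace ℝ (Fin m) => coords z p :=
  (EuclideanSpace.proj (𝕜 := ℝ) p.2).continuous.measurable.comp (measurable_pi_apply p.1)

theorem measurable_block (a : ℤ) (n : ℕ) :
    Measurable (block a n : (ℤ → EuclideanSpace ℝ (Fin m)) → _) :=
  (PiLp.continuous_toLp 2 _).measurable.comp
    (measurable_pi_lambda _ fun p => measurable_coords (a + ((p.1 : ℕ) : ℤ), p.2))

theorem measurable_output_coords (u : ℤ × Fin m →₀ ℝ) :
    Measurable fun z : ℤ → EuclideanSpace ℝ (Fin m) => output (coords z) u := by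
  obtain ⟨N, hN⟩ := exists_abs_time_le u.support
  simp only [output_coords_eq_inner hN]
  exact measurable_const.inner (measurable_block _ _)

theorem comp_restrict_eq_output (I : Finset ℤ) (T : (I → EuclideanSpace ℝ (Fin m)) →ₗ[ℝ] ℝ) :
    ∃ u : ℤ × Fin m →₀ ℝ, ∀ z, T (I.restrict z) = output (coords z) u := by
  let e (i : I) (c : Fin m) : I → EuclideanSpace ℝ (Fin m) :=
    Pi.single i (EuclideanSpace.single c 1)
  refine ⟨∑ i : I, ∑ c : Fin m, Finsupp.single ((i : ℤ), c) (T (e i c)), fun z => ?_⟩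
  have hz : I.restrict z = ∑ i : I, ∑ c : Fin m, z i c • e i c := by
    funext j
    rw [Finset.sum_apply, Finset.sum_eq_single j]
    · ext a
      simp [e, Finset.sum_apply, Pi.single_apply]
    · intro i _ hi
      simp [e, Finset.sum_apply, Pi.single_eq_of_ne hi.symm]
    · simp
  rw [hz]
  simp only [map_sum, map_smul, output, Finsupp.linearCombination_single, smul_eq_mul, coords,
    mul_comm]

theorem measure_ext_of_map_output {μ ν : Measure (ℤ → EuclideanSpace ℝ (Fin m))}
    [IsFiniteMeasure μ] [IsFiniteMeasure ν]
    (h : ∀ u : ℤ × Fin m →₀ ℝ, μ.map (fun z => output (coords z) u) =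
      ν.map fun z => output (coords z) u) : μ = ν := by
  refine IsProjectiveLimit.unique (P := fun I : Finset ℤ => ν.map I.restrict) (fun I => ?_)
    fun I => rfl
  refine Measure.ext_of_charFunDual (funext fun T => ?_)
  obtain ⟨u, hu⟩ := comp_restrict_eq_output I T.toLinearMap
  have hmap : ∀ ρ : Measure (ℤ → EuclideanSpace ℝ (Fin m)),
      (ρ.map I.restrict).map T = ρ.map fun z => output (coords z) u := fun ρ => by
    rw [Measure.map_map T.continuous.measurable (Finset.measurable_restrict I)]
    exact congrArg ρ.map (funext hu)
  rw [charFunDual_eq_charFun_map_one, charFunDual_eq_charFun_map_one, hmap, hmap, h u]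

variable {Ω Ω' : Type*} [MeasurableSpace Ω] [MeasurableSpace Ω'] {P : Measure Ω} {P' : Measure Ω'}
  {x : ℤ → Ω → EuclideanSpace ℝ (Fin m)} {y : ℤ → Ω' → EuclideanSpace ℝ (Fin m)}

theorem map_output_coords (hx : ∀ k, Measurable (x k)) {N : ℕ} {u : ℤ × Fin m →₀ ℝ}
    (hu : ∀ p ∈ u.support, |p.1| ≤ N) :
    P.map (fun s => output (coords fun k => x k s) u) =
      (P.map fun s => block (-(N : ℤ)) (2 * N) fun k => x k s).map (inner ℝ (windowVec N u)) := by
  have hblock : Measurable fun s => block (-(N : ℤ)) (2 * N) fun k => x k s :=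
    (measurable_block _ _).comp (measurable_pi_lambda _ hx)
  rw [Measure.map_map (by fun_prop) hblock]
  exact congrArg P.map (funext fun s => output_coords_eq_inner hu _)

theorem IsEllipticalProcess.map_output_coords_eq {g : ℕ → ℝ → ℝ≥0}
    (hxe : IsEllipticalProcess P x g) (hye : IsEllipticalProcess P' y g)
    (hx : ∀ k, Measurable (x k)) (hy : ∀ k, Measurable (y k)) {u v : ℤ × Fin m →₀ ℝ}
    (h : ∫ r, r ^ 2 ∂P.map (fun s => output (coords fun k => x k s) u) =
      ∫ r, r ^ 2 ∂P'.map fun s => output (coords fun k => y k s) v)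
    (h0 : ∫ r, r ^ 2 ∂P.map (fun s => output (coords fun k => x k s) u) ≠ 0) :
    P.map (fun s => output (coords fun k => x k s) u) =
      P'.map fun s => output (coords fun k => y k s) v := by
  obtain ⟨N, hN⟩ := exists_abs_time_le (u.support ∪ v.support)
  have hu := map_output_coords (P := P) hx fun p hp => hN p (Finset.mem_union_left _ hp)
  have hv := map_output_coords (P := P') hy fun p hp => hN p (Finset.mem_union_right _ hp)
  rw [hu] at h0
  rw [hu, hv] at h ⊢
  exact (hxe _ _).map_inner_eq (hye _ _) h h0

end PathFunctionals

section SecondOrder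

variable {m : ℕ} {Ω Ω' : Type*} [MeasurableSpace Ω] [MeasurableSpace Ω'] {P : Measure Ω}
  {P' : Measure Ω'} {x y : ℤ → Ω → EuclideanSpace ℝ (Fin m)}
  {x' : ℤ → Ω' → EuclideanSpace ℝ (Fin m)}

/-- The coordinates of a square integrable process as vectors of `L²`. -/
def procVec (h : ∀ k, MemLp (x k) 2 P) (p : ℤ × Fin m) : Lp ℝ 2 P :=
  ((h p.1).eval_piLp p.2).toLp _

theorem coeFn_procVec (h : ∀ k, MemLp (x k) 2 P) (p : ℤ × Fin m) :
    procVec h p =ᵐ[P] fun s => coords (fun k => x k s) p :=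
  MemLp.coeFn_toLp _

theorem coeFn_output_procVec (h : ∀ k, MemLp (x k) 2 P) (u : ℤ × Fin m →₀ ℝ) :
    output (procVec h) u =ᵐ[P] fun s => output (coords fun k => x k s) u := by
  induction u using Finsupp.induction_linear with
  | zero =>
    simp only [map_zero]
    exact Lp.coeFn_zero _ _ _
  | add u v hu hv =>
    simp only [map_add]
    filter_upwards [Lp.coeFn_add (output (procVec h) u) (output (procVec h) v), hu, hv]
      with s hadd hu hv
    rw [hadd, Pi.add_apply, hu, hv]
  | single p r =>
    simp only [output, Finsupp.linearCombination_single]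
    filter_upwards [Lp.coeFn_smul r (procVec h p), coeFn_procVec h p] with s hsmul hp
    rw [hsmul, Pi.smul_apply, hp]

theorem inner_Lp_eq_integral {f g : Lp ℝ 2 P} {F G : Ω → ℝ} (hf : f =ᵐ[P] F) (hg : g =ᵐ[P] G) :
    inner ℝ f g = ∫ s, F s * G s ∂P := by
  rw [L2.inner_def]
  refine integral_congr_ae ?_
  filter_upwards [hf, hg] with s hf hg
  rw [hf, hg, Real.inner_apply, mul_comm]

theorem norm_sq_Lp_eq_integral {f : Lp ℝ 2 P} {F : Ω → ℝ} (hf : f =ᵐ[P] F) :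
    ‖f‖ ^ 2 = ∫ s, F s ^ 2 ∂P := by
  rw [← real_inner_self_eq_norm_sq, inner_Lp_eq_integral hf hf]
  simp only [sq]

theorem IsStationary.inner_procVec (h : IsStationary P x) (p q : ℤ × Fin m) :
    inner ℝ (procVec h.memLp p) (procVec h.memLp q) = autocorr P x 0 (q.1 - p.1) p.2 q.2 := by
  rw [inner_Lp_eq_integral (coeFn_procVec _ p) (coeFn_procVec _ q), h.autocorr_eq 0 p.1]
  simp only [autocorr, coords, of_apply, add_sub_cancel]

section Cost

theorem norm_sq_procVec_sub (hx : ∀ k, MemLp (x k) 2 P) (hy : ∀ k, MemLp (y k) 2 P)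
    (k : ℤ) (c : Fin m) :
    ‖procVec hx (k, c) - procVec hy (k, c)‖ ^ 2 = ∫ s, (x k s c - y k s c) ^ 2 ∂P := by
  refine norm_sq_Lp_eq_integral ?_
  filter_upwards [Lp.coeFn_sub (procVec hx (k, c)) (procVec hy (k, c)),
    coeFn_procVec hx (k, c), coeFn_procVec hy (k, c)] with s hsub hx hy
  rw [hsub, Pi.sub_apply, hx, hy, coords, coords]

theorem enorm_block_sub_rpow_two (a b : ℤ → EuclideanSpace ℝ (Fin m)) (i : ℕ) :
    ‖block 0 i a - block 0 i b‖ₑ ^ (2 : ℝ) =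
      ENNReal.ofReal (∑ k ∈ Finset.range (i + 1), ∑ c, (a k c - b k c) ^ 2) := by
  rw [← ofReal_norm, ENNReal.ofReal_rpow_of_nonneg (norm_nonneg _) zero_le_two,
    Real.rpow_two, EuclideanSpace.norm_sq_eq, Fintype.sum_prod_type, Finset.sum_range]
  simp [block]

theorem lintegral_block_sub (hx : ∀ k, MemLp (x k) 2 P) (hy : ∀ k, MemLp (y k) 2 P) (i : ℕ) :
    (∫⁻ s, ‖block 0 i (fun k => x k s) - block 0 i (fun k => y k s)‖ₑ ^ (2 : ℝ) ∂P) /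
        ((i : ℝ≥0∞) + 1) =
      ENNReal.ofReal
        (cesaro (fun k : ℕ => ∑ c, ‖procVec hx (k, c) - procVec hy (k, c)‖ ^ 2) i) := by
  have hsq : ∀ (k : ℤ) c, Integrable (fun s => (x k s c - y k s c) ^ 2) P := fun k c =>
    (((hx k).eval_piLp c).sub ((hy k).eval_piLp c)).integrable_sq
  have hsum : ∀ k ∈ Finset.range (i + 1), Integrable (fun s => ∑ c, (x k s c - y k s c) ^ 2) P :=
    fun k _ => integrable_finsetSum _ fun c _ => hsq k c
  have hi : ((i : ℝ≥0∞) + 1) = ENNReal.ofReal ((i : ℝ) + 1) := by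
    rw [ENNReal.ofReal_add (Nat.cast_nonneg _) zero_le_one, ENNReal.ofReal_natCast,
      ENNReal.ofReal_one]
  simp only [enorm_block_sub_rpow_two]
  rw [← ofReal_integral_eq_lintegral_ofReal (integrable_finsetSum _ hsum)
    (.of_forall fun s => Finset.sum_nonneg fun _ _ => Finset.sum_nonneg fun _ _ => sq_nonneg _),
    hi, ← ENNReal.ofReal_div_of_pos (by positivity), cesaro, smul_eq_mul, div_eq_inv_mul,
    integral_finsetSum _ hsum]
  simp only [norm_sq_procVec_sub, integral_finsetSum _ fun c _ => hsq _ c]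

end Cost

section PowerSpectrum

theorem integral_exp_int (n : ℤ) :
    ∫ w in (0 : ℝ)..(2 * Real.pi), Complex.exp (Complex.I * w * n) =
      if n = 0 then (2 * Real.pi : ℂ) else 0 := by
  split_ifs with h
  · simp [h]
  · have hc : Complex.I * n ≠ 0 := mul_ne_zero Complex.I_ne_zero (by exact_mod_cast h)
    have hperiod : Complex.exp (Complex.I * n * ((2 * Real.pi : ℝ) : ℂ)) = 1 :=
      Complex.exp_eq_one_iff.2 ⟨n, by push_cast; ring⟩
    simp only [mul_right_comm Complex.I _ (n : ℂ)]
    rw [integral_exp_mul_complex hc, hperiod]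
    simp

theorem integral_exp_mul_tsum {c : ℤ → ℂ} (hc : Summable fun k => ‖c k‖) (n : ℤ) :
    ∫ w in (0 : ℝ)..(2 * Real.pi), Complex.exp (Complex.I * w * n) *
      ∑' k : ℤ, Complex.exp (-(Complex.I * w * k)) * c k = 2 * Real.pi * c n := by
  have hnorm : ∀ (w : ℝ) (k : ℤ), ‖Complex.exp (-(Complex.I * w * k)) * c k‖ = ‖c k‖ :=
    fun w k => by rw [norm_mul, Complex.norm_exp]; simp
  have hint : HasSum (fun k : ℤ => ∫ w in (0 : ℝ)..(2 * Real.pi),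
      Complex.exp (Complex.I * w * n) * (Complex.exp (-(Complex.I * w * k)) * c k))
      (∫ w in (0 : ℝ)..(2 * Real.pi), Complex.exp (Complex.I * w * n) *
        ∑' k : ℤ, Complex.exp (-(Complex.I * w * k)) * c k) := by
    refine intervalIntegral.hasSum_integral_of_dominated_convergence
      (fun k _ => ‖c k‖) (fun k => Continuous.aestronglyMeasurable (by fun_prop))
      (fun k => .of_forall fun w _ => ?_) (.of_forall fun w _ => hc) intervalIntegrable_const
      (.of_forall fun w _ => (Summable.hasSum ?_).mul_left _)
    · rw [norm_mul, hnorm, Complex.norm_exp]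
      simp
    · exact .of_norm (by simpa only [hnorm] using hc)
  have hterm : ∀ k : ℤ, ∫ w in (0 : ℝ)..(2 * Real.pi),
      Complex.exp (Complex.I * w * n) * (Complex.exp (-(Complex.I * w * k)) * c k) =
      if k = n then 2 * Real.pi * c n else 0 := fun k => by
    have hexp : ∀ w : ℝ, Complex.exp (Complex.I * w * n) *
        (Complex.exp (-(Complex.I * w * k)) * c k) =
        Complex.exp (Complex.I * w * (n - k : ℤ)) * c k := fun w => by
      rw [← mul_assoc, ← Complex.exp_add]
      push_cast
      ring_nf
    simp only [hexp]
    rw [intervalIntegral.integral_mul_const, integral_exp_int]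
    simp only [sub_eq_zero, eq_comm (a := n), ite_mul, zero_mul]
    split_ifs with h
    · rw [h]
    · rfl
  simp only [hterm] at hint
  exact hint.unique (hasSum_ite_eq n _)

theorem spectrumTerm_apply (w : ℝ) (k : ℤ) (a b : Fin m) :
    spectrumTerm P x w k a b =
      Complex.exp (-(Complex.I * w * k)) * (autocorr P x 0 k a b : ℂ) := rfl

theorem norm_spectrumTerm_apply (w : ℝ) (k : ℤ) (a b : Fin m) :
    ‖spectrumTerm P x w k a b‖ = |autocorr P x 0 k a b| := by
  rw [spectrumTerm_apply, norm_mul, Complex.norm_exp]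
  simp

theorem hasSum_powerSpectrum_apply (hsum : ∀ w : ℝ, Summable (spectrumTerm P x w))
    (w : ℝ) (a b : Fin m) :
    HasSum (fun k => spectrumTerm P x w k a b) (powerSpectrum P x w a b) :=
  Pi.hasSum.1 (Pi.hasSum.1 (hsum w).hasSum a) b

theorem summable_abs_autocorr (hsum : ∀ w : ℝ, Summable (spectrumTerm P x w))
    (a b : Fin m) : Summable fun k => |autocorr P x 0 k a b| := by
  simpa only [norm_spectrumTerm_apply] using (hasSum_powerSpectrum_apply hsum 0 a b).summable.norm

theorem continuous_powerSpectrum (hsum : ∀ w : ℝ, Summable (spectrumTerm P x w)) :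
    Continuous (powerSpectrum P x) := by
  refine continuous_matrix fun a b => ?_
  simp only [← (hasSum_powerSpectrum_apply hsum _ a b).tsum_eq]
  refine continuous_tsum (fun k => ?_) (summable_abs_autocorr hsum a b)
    fun k w => (norm_spectrumTerm_apply w k a b).le
  simp only [spectrumTerm_apply]
  fun_prop

theorem isRealSymbol_powerSpectrum (hsum : ∀ w : ℝ, Summable (spectrumTerm P x w)) :
    IsRealSymbol (powerSpectrum P x) where
  continuous := continuous_powerSpectrum hsum
  periodic w := by
    refine tsum_congr fun k => ?_
    rw [spectrumTerm, spectrumTerm]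
    congr 1
    exact Complex.exp_eq_exp_iff_exists_int.2 ⟨-k, by push_cast; ring⟩
  neg w := by
    ext a b
    have hconj := (hasSum_powerSpectrum_apply hsum w a b).map (starRingEnd ℂ)
      Complex.continuous_conj
    rw [RingHom.mapMatrix_apply, map_apply]
    refine (hasSum_powerSpectrum_apply hsum (-w) a b).unique ?_
    convert hconj using 1
    funext k
    simp only [Function.comp_apply, spectrumTerm_apply]
    rw [map_mul, Complex.conj_ofReal, ← Complex.exp_conj]
    simp

theorem star_coordResp_dotProduct_mulVec (M : Matrix (Fin m) (Fin m) ℂ) (p q : ℤ × Fin m) (w : ℝ) :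
    star (coordResp p w) ⬝ᵥ (M *ᵥ coordResp q w) =
      Complex.exp (Complex.I * w * (q.1 - p.1 : ℤ)) * M p.2 q.2 := by
  have hexp : Complex.exp (Complex.I * w * (q.1 - p.1 : ℤ)) =
      conj (Complex.exp (Complex.I * w * p.1)) * Complex.exp (Complex.I * w * q.1) := by
    rw [← Complex.exp_conj, ← Complex.exp_add]
    congr 1
    simp only [Int.cast_sub, map_mul, Complex.conj_I, Complex.conj_ofReal, neg_mul, map_intCast]
    ring
  rw [hexp, coordResp, coordResp, ← Pi.single_star, mulVec_single, single_dotProduct]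
  simp [mul_assoc, mul_comm]

theorem IsStationary.hasSpectrum (h : IsStationary P x)
    (hsum : ∀ w : ℝ, Summable (spectrumTerm P x w)) :
    HasSpectrum (procVec h.memLp) (powerSpectrum P x) where
  continuous := continuous_powerSpectrum hsum
  inner_eq p q := by
    have hfourier := integral_exp_mul_tsum (c := fun k => (autocorr P x 0 k p.2 q.2 : ℂ))
      (by simpa using summable_abs_autocorr hsum p.2 q.2) (q.1 - p.1)
    simp only [← spectrumTerm_apply, (hasSum_powerSpectrum_apply hsum _ _ _).tsum_eq] at hfourier
    have hcont : Continuous fun w : ℝ =>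
        Complex.exp (Complex.I * w * (q.1 - p.1 : ℤ)) * powerSpectrum P x w p.2 q.2 :=
      (by fun_prop : Continuous fun w : ℝ => Complex.exp (Complex.I * w * (q.1 - p.1 : ℤ))).mul
        ((continuous_powerSpectrum hsum).matrix_elem p.2 q.2)
    have hre := Complex.reCLM.intervalIntegral_comp_comm
      (hcont.intervalIntegrable (μ := volume) 0 (2 * Real.pi))
    simp only [Complex.reCLM_apply, hfourier] at hre
    simp only [specForm, star_coordResp_dotProduct_mulVec, hre, h.inner_procVec]
    have hpi := Real.pi_ne_zero
    simp only [one_div, _root_.mul_inv_rev, Complex.mul_re, Complex.re_ofNat, Complex.ofReal_re,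
      Complex.im_ofNat, Complex.ofReal_im, mul_zero, sub_zero, Complex.mul_im, zero_mul, add_zero]
    field_simp

end PowerSpectrum

section LawInvariance

theorem memLp_of_law (hx : ∀ k, Measurable (x k)) (hx' : ∀ k, Measurable (x' k))
    (h : processLaw P x = processLaw P' x') (hm : ∀ k, MemLp (x k) 2 P) (k : ℤ) :
    MemLp (x' k) 2 P' := by
  have hk : AEStronglyMeasurable (fun z : ℤ → EuclideanSpace ℝ (Fin m) => z k)
      (processLaw P' x') := (measurable_pi_apply k).aestronglyMeasurable
  rw [processLaw] at hk
  refine (memLp_map_measure_iff hk (measurable_pi_lambda _ hx').aemeasurable).1 ?_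
  rw [← processLaw] at hk ⊢
  rw [← h] at hk ⊢
  exact (memLp_map_measure_iff hk (measurable_pi_lambda _ hx).aemeasurable).2 (hm k)

theorem autocorr_eq_integral_processLaw (hx : ∀ k, Measurable (x k)) (i k : ℤ) (a b : Fin m) :
    autocorr P x i k a b = ∫ z, coords z (i, a) * coords z (i + k, b) ∂processLaw P x := by
  have hmeas : Measurable fun z : ℤ → EuclideanSpace ℝ (Fin m) =>
      coords z (i, a) * coords z (i + k, b) := (measurable_coords _).mul (measurable_coords _)
  rw [processLaw, integral_map (measurable_pi_lambda _ hx).aemeasurable hmeas.aestronglyMeasurable]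
  rfl

theorem autocorr_eq_of_law (hx : ∀ k, Measurable (x k)) (hx' : ∀ k, Measurable (x' k))
    (h : processLaw P x = processLaw P' x') : autocorr P x = autocorr P' x' := by
  ext i k a b
  rw [autocorr_eq_integral_processLaw hx, autocorr_eq_integral_processLaw hx', h]

theorem IsStationary.of_law (hs : IsStationary P x) (hx : ∀ k, Measurable (x k))
    (hx' : ∀ k, Measurable (x' k)) (h : processLaw P x = processLaw P' x') :
    IsStationary P' x' where
  memLp := memLp_of_law hx hx' h hs.memLp
  autocorr_eq i j k := autocorr_eq_of_law hx hx' h ▸ hs.autocorr_eq i j k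

theorem spectrumTerm_eq_of_law (hx : ∀ k, Measurable (x k)) (hx' : ∀ k, Measurable (x' k))
    (h : processLaw P x = processLaw P' x') : spectrumTerm P x = spectrumTerm P' x' := by
  funext w k
  rw [spectrumTerm, spectrumTerm, autocorr_eq_of_law hx hx' h]

end LawInvariance

end SecondOrder

section Law

variable {m : ℕ} {Ω Ω' : Type*} [MeasurableSpace Ω] [MeasurableSpace Ω'] {P : Measure Ω}
  {P' : Measure Ω'} {x : ℤ → Ω → EuclideanSpace ℝ (Fin m)} {y : ℤ → Ω' → EuclideanSpace ℝ (Fin m)}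

theorem map_eq_of_tendsto_Lp [IsProbabilityMeasure P] [IsProbabilityMeasure P'] {p : ℝ≥0∞}
    [Fact (1 ≤ p)] {f : ℕ → Lp ℝ p P} {g : ℕ → Lp ℝ p P'} {f₀ : Lp ℝ p P} {g₀ : Lp ℝ p P'}
    (hf : Tendsto f atTop (𝓝 f₀)) (hg : Tendsto g atTop (𝓝 g₀))
    (h : ∀ n, P.map (f n) = P'.map (g n)) : P.map f₀ = P'.map g₀ := by
  have hf' := (tendstoInMeasure_of_tendsto_Lp hf).tendstoInDistribution
    fun n => (Lp.aestronglyMeasurable (f n)).aemeasurable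
  have hg' := (tendstoInMeasure_of_tendsto_Lp hg).tendstoInDistribution
    fun n => (Lp.aestronglyMeasurable (g n)).aemeasurable
  exact congrArg Subtype.val (tendsto_nhds_unique (X := ProbabilityMeasure ℝ) hf'.tendsto
    (hg'.tendsto.congr fun n => Subtype.ext (h n).symm))

theorem map_output_procVec (hx : ∀ k, MemLp (x k) 2 P) (u : ℤ × Fin m →₀ ℝ) :
    P.map (output (procVec hx) u) = P.map fun s => output (coords fun k => x k s) u :=
  Measure.map_congr (coeFn_output_procVec hx u)

theorem integral_sq_map_coeFn (f : Lp ℝ 2 P) : ∫ r, r ^ 2 ∂P.map f = ‖f‖ ^ 2 := by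
  rw [integral_map (Lp.aestronglyMeasurable f).aemeasurable (by fun_prop),
    norm_sq_Lp_eq_integral (ae_eq_refl _)]

theorem map_coeFn_zero [IsProbabilityMeasure P] :
    P.map (0 : Lp ℝ 2 P) = Measure.dirac 0 := by
  rw [Measure.map_congr (Lp.coeFn_zero ℝ 2 P)]
  exact (Measure.map_const P 0).trans (by rw [measure_univ, one_smul])

theorem IsEllipticalProcess.map_output_procVec_eq [IsProbabilityMeasure P]
    [IsProbabilityMeasure P'] {g : ℕ → ℝ → ℝ≥0}
    (hxe : IsEllipticalProcess P x g) (hye : IsEllipticalProcess P' y g)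
    (hx : ∀ k, Measurable (x k)) (hy : ∀ k, Measurable (y k))
    (hx2 : ∀ k, MemLp (x k) 2 P) (hy2 : ∀ k, MemLp (y k) 2 P') {u v : ℤ × Fin m →₀ ℝ}
    (h : ‖output (procVec hx2) u‖ = ‖output (procVec hy2) v‖) :
    P.map (output (procVec hx2) u) = P'.map (output (procVec hy2) v) := by
  by_cases h0 : ‖output (procVec hx2) u‖ = 0
  · rw [norm_eq_zero.1 h0, norm_eq_zero.1 (h.symm.trans h0), map_coeFn_zero, map_coeFn_zero]
  · rw [map_output_procVec, map_output_procVec]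
    refine hxe.map_output_coords_eq hye hx hy ?_ ?_
    · rw [← map_output_procVec hx2, ← map_output_procVec hy2, integral_sq_map_coeFn,
        integral_sq_map_coeFn, h]
    · rw [← map_output_procVec hx2, integral_sq_map_coeFn]
      exact pow_ne_zero 2 h0

theorem IsEllipticalProcess.map_eq_of_mem_closure [IsProbabilityMeasure P]
    [IsProbabilityMeasure P'] {g : ℕ → ℝ → ℝ≥0}
    (hxe : IsEllipticalProcess P x g) (hye : IsEllipticalProcess P' y g)
    (hx : ∀ k, Measurable (x k)) (hy : ∀ k, Measurable (y k))
    (hx2 : ∀ k, MemLp (x k) 2 P) (hy2 : ∀ k, MemLp (y k) 2 P') {f : Lp ℝ 2 P}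
    (hf : f ∈ closure (Set.range (output (procVec hx2)))) {v : ℤ × Fin m →₀ ℝ}
    (h : ‖f‖ = ‖output (procVec hy2) v‖) : P.map f = P'.map (output (procVec hy2) v) := by
  set t := ‖output (procVec hy2) v‖ with ht
  rcases eq_or_ne t 0 with h0 | h0
  · rw [norm_eq_zero.1 (h.trans h0), norm_eq_zero.1 (ht.symm.trans h0), map_coeFn_zero,
      map_coeFn_zero]
  · obtain ⟨f', hf'range, hf'⟩ := mem_closure_iff_seq_limit.1 hf
    choose u hu using hf'range
    -- `f' n` need not have the norm of `f`, so the target is rescaled to match it.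
    have hr : Tendsto (fun n => ‖f' n‖ / t) atTop (𝓝 1) := by
      simpa only [h, div_self h0] using hf'.norm.div_const t
    have hg : Tendsto (fun n => output (procVec hy2) ((‖f' n‖ / t) • v)) atTop
        (𝓝 (output (procVec hy2) v)) := by
      simpa only [map_smul, one_smul] using hr.smul_const (output (procVec hy2) v)
    refine map_eq_of_tendsto_Lp hf' hg fun n => ?_
    rw [← hu]
    refine hxe.map_output_procVec_eq hye hx hy hx2 hy2 ?_
    rw [map_smul, norm_smul, ← ht, norm_div, norm_norm, Real.norm_of_nonneg (ht ▸ norm_nonneg _),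
      div_mul_cancel₀ _ h0]

/-- The process with given square integrable coordinates. -/
def procOf (η : ℤ × Fin m → Lp ℝ 2 P) (k : ℤ) (s : Ω) : EuclideanSpace ℝ (Fin m) :=
  WithLp.toLp 2 fun c => η (k, c) s

theorem measurable_procOf (η : ℤ × Fin m → Lp ℝ 2 P) (k : ℤ) : Measurable (procOf η k) :=
  (PiLp.continuous_toLp 2 _).measurable.comp
    (measurable_pi_lambda _ fun c => (Lp.stronglyMeasurable (η (k, c))).measurable)

theorem memLp_procOf (η : ℤ × Fin m → Lp ℝ 2 P) (k : ℤ) : MemLp (procOf η k) 2 P :=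
  MemLp.of_eval_piLp fun c => Lp.memLp (η (k, c))

theorem procVec_procOf (η : ℤ × Fin m → Lp ℝ 2 P) : procVec (memLp_procOf η) = η :=
  funext fun p => Lp.toLp_coeFn (η p) (Lp.memLp _)

theorem IsEllipticalProcess.processLaw_procOf [IsProbabilityMeasure P]
    [IsProbabilityMeasure P'] {g : ℕ → ℝ → ℝ≥0}
    (hxe : IsEllipticalProcess P x g) (hye : IsEllipticalProcess P' y g)
    (hx : ∀ k, Measurable (x k)) (hy : ∀ k, Measurable (y k))
    (hx2 : ∀ k, MemLp (x k) 2 P) (hy2 : ∀ k, MemLp (y k) 2 P') {η : ℤ × Fin m → Lp ℝ 2 P}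
    (hη : ∀ p, η p ∈ closure (Set.range (output (procVec hx2))))
    (hnorm : ∀ u, ‖output η u‖ = ‖output (procVec hy2) u‖) :
    processLaw P (procOf η) = processLaw P' y := by
  have hmη : Measurable fun s k => procOf η k s := measurable_pi_lambda _ (measurable_procOf η)
  have hmy : Measurable fun s k => y k s := measurable_pi_lambda _ hy
  have : IsFiniteMeasure (processLaw P (procOf η)) := Measure.isFiniteMeasure_map P _
  have : IsFiniteMeasure (processLaw P' y) := Measure.isFiniteMeasure_map P' _
  refine measure_ext_of_map_output fun u => ?_
  have hlaw := hxe.map_eq_of_mem_closure hye hx hy hx2 hy2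
    (output_mem_closure_range hη u) (hnorm u)
  rw [processLaw, processLaw, Measure.map_map (measurable_output_coords u) hmη,
    Measure.map_map (measurable_output_coords u) hmy]
  rw [map_output_procVec, ← procVec_procOf η, map_output_procVec] at hlaw
  exact hlaw

end Law

section Main

variable {m : ℕ} {Ω Ω' : Type*} [MeasurableSpace Ω] [MeasurableSpace Ω'] {P : Measure Ω}
  {P' : Measure Ω'} {x : ℤ → Ω → EuclideanSpace ℝ (Fin m)} {y : ℤ → Ω' → EuclideanSpace ℝ (Fin m)}

theorem ofReal_meanTrace_buresMatrix_le_limsup {x y : ℤ → Ω → EuclideanSpace ℝ (Fin m)}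
    (hxs : IsStationary P x) (hys : IsStationary P y)
    (hxsum : ∀ w : ℝ, Summable (spectrumTerm P x w))
    (hysum : ∀ w : ℝ, Summable (spectrumTerm P y w))
    (hxpos : ∀ w : ℝ, (powerSpectrum P x w).PosDef)
    (hypos : ∀ w : ℝ, (powerSpectrum P y w).PosDef) :
    ENNReal.ofReal (meanTrace fun w => buresMatrix (powerSpectrum P x w) (powerSpectrum P y w)) ≤
      limsup (fun i : ℕ =>
        (∫⁻ s, ‖block 0 i (fun k => x k s) - block 0 i (fun k => y k s)‖ₑ ^ (2 : ℝ) ∂P) /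
          ((i : ℝ≥0∞) + 1)) atTop := by
  have hΦ := isRealSymbol_powerSpectrum hxsum
  have hΨ := isRealSymbol_powerSpectrum hysum
  refine le_of_forall_gt_imp_ge_of_dense fun C hC => ?_
  rcases eq_or_ne C ⊤ with rfl | hCtop
  · exact le_top
  · refine ENNReal.ofReal_le_of_le_toReal ?_
    rw [meanTrace_buresMatrix hΦ hΨ hxpos hypos]
    refine (hxs.hasSpectrum hxsum).meanTrace_le_of_cesaro_le (hys.hasSpectrum hysum) hΦ hΨ hxpos
      hypos ?_
    filter_upwards [eventually_lt_of_limsup_lt hC] with i hi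
    rw [lintegral_block_sub hxs.memLp hys.memLp] at hi
    exact (ENNReal.ofReal_le_iff_le_toReal hCtop).1 hi.le

theorem ofReal_meanTrace_buresMatrix_le_of_mem_couplings
    (hx : ∀ k, Measurable (x k)) (hy : ∀ k, Measurable (y k))
    (hxs : IsStationary P x) (hys : IsStationary P' y)
    (hxsum : ∀ w : ℝ, Summable (spectrumTerm P x w))
    (hysum : ∀ w : ℝ, Summable (spectrumTerm P' y w))
    (hxpos : ∀ w : ℝ, (powerSpectrum P x w).PosDef)
    (hypos : ∀ w : ℝ, (powerSpectrum P' y w).PosDef)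
    {γ : Measure ((ℤ → EuclideanSpace ℝ (Fin m)) × (ℤ → EuclideanSpace ℝ (Fin m)))}
    (hγ : γ ∈ couplings (processLaw P x) (processLaw P' y)) :
    ENNReal.ofReal (meanTrace fun w => buresMatrix (powerSpectrum P x w) (powerSpectrum P' y w)) ≤
      limsup (fun i : ℕ =>
        (∫⁻ z, ‖block 0 i z.1 - block 0 i z.2‖ₑ ^ (2 : ℝ) ∂γ) / ((i : ℝ≥0∞) + 1)) atTop := by
  have hfst : ∀ k, Measurable fun z : (ℤ → EuclideanSpace ℝ (Fin m)) ×
      (ℤ → EuclideanSpace ℝ (Fin m)) => z.1 k := fun k =>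
    (measurable_pi_apply k).comp measurable_fst
  have hsnd : ∀ k, Measurable fun z : (ℤ → EuclideanSpace ℝ (Fin m)) ×
      (ℤ → EuclideanSpace ℝ (Fin m)) => z.2 k := fun k =>
    (measurable_pi_apply k).comp measurable_snd
  have hlawx : processLaw P x = processLaw γ fun k z => z.1 k := hγ.1.symm
  have hlawy : processLaw P' y = processLaw γ fun k z => z.2 k := hγ.2.symm
  have htermx := spectrumTerm_eq_of_law hx hfst hlawx
  have htermy := spectrumTerm_eq_of_law hy hsnd hlawy
  simp only [powerSpectrum, htermx, htermy] at hxsum hysum hxpos hypos ⊢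
  exact ofReal_meanTrace_buresMatrix_le_limsup (hxs.of_law hx hfst hlawx)
    (hys.of_law hy hsnd hlawy) hxsum hysum hxpos hypos

theorem exists_procOf_law_eq [IsProbabilityMeasure P] [IsProbabilityMeasure P']
    (hx : ∀ k, Measurable (x k)) (hy : ∀ k, Measurable (y k))
    (hxs : IsStationary P x) (hys : IsStationary P' y) {g : ℕ → ℝ → ℝ≥0}
    (hxe : IsEllipticalProcess P x g) (hye : IsEllipticalProcess P' y g)
    (hxsum : ∀ w : ℝ, Summable (spectrumTerm P x w))
    (hysum : ∀ w : ℝ, Summable (spectrumTerm P' y w))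
    (hxpos : ∀ w : ℝ, (powerSpectrum P x w).PosDef)
    (hypos : ∀ w : ℝ, (powerSpectrum P' y w).PosDef) :
    ∃ η : ℤ × Fin m → Lp ℝ 2 P, processLaw P (procOf η) = processLaw P' y ∧
      ∀ k, ∑ c, ‖procVec hxs.memLp (k, c) - η (k, c)‖ ^ 2 =
        meanTrace fun w => buresMatrix (powerSpectrum P x w) (powerSpectrum P' y w) := by
  have hΦ := isRealSymbol_powerSpectrum hxsum
  have hΨ := isRealSymbol_powerSpectrum hysum
  obtain ⟨η, hη, hmem, hcost⟩ := (hxs.hasSpectrum hxsum).exists_optimal hΦ hΨ hxpos hypos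
  refine ⟨η, hxe.processLaw_procOf hye hx hy hxs.memLp hys.memLp hmem fun u => ?_, fun k => ?_⟩
  · rw [← sq_eq_sq₀ (norm_nonneg _) (norm_nonneg _), hη.norm_sq_output,
      (hys.hasSpectrum hysum).norm_sq_output]
  · rw [hcost, meanTrace_buresMatrix hΦ hΨ hxpos hypos]

theorem exists_coupling_lintegral_eq {x y : ℤ → Ω → EuclideanSpace ℝ (Fin m)}
    (hx : ∀ k, Measurable (x k)) (hy : ∀ k, Measurable (y k))
    (hx2 : ∀ k, MemLp (x k) 2 P) (hy2 : ∀ k, MemLp (y k) 2 P) :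
    ∃ γ ∈ couplings (processLaw P x) (processLaw P y), ∀ i : ℕ,
      (∫⁻ z, ‖block 0 i z.1 - block 0 i z.2‖ₑ ^ (2 : ℝ) ∂γ) / ((i : ℝ≥0∞) + 1) =
        ENNReal.ofReal
          (cesaro (fun k : ℕ => ∑ c, ‖procVec hx2 (k, c) - procVec hy2 (k, c)‖ ^ 2) i) := by
  have hpair : Measurable fun s => (fun k => x k s, fun k => y k s) :=
    (measurable_pi_lambda _ hx).prodMk (measurable_pi_lambda _ hy)
  refine ⟨P.map fun s => (fun k => x k s, fun k => y k s),
    ⟨Measure.map_map measurable_fst hpair, Measure.map_map measurable_snd hpair⟩, fun i => ?_⟩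
  have hdist : Measurable fun z : (ℤ → EuclideanSpace ℝ (Fin m)) ×
      (ℤ → EuclideanSpace ℝ (Fin m)) => ‖block 0 i z.1 - block 0 i z.2‖ₑ ^ (2 : ℝ) :=
    (((measurable_block 0 i).comp measurable_fst).sub
      ((measurable_block 0 i).comp measurable_snd)).enorm.pow_const 2
  rw [lintegral_map hdist hpair, lintegral_block_sub hx2 hy2]

end Main

end SpectralWasserstein

end

theorem theorem1 {m : ℕ}
    {Ω : Type*} [MeasurableSpace Ω] (P : Measure Ω) [IsProbabilityMeasure P]
    {Ω' : Type*} [MeasurableSpace Ω'] (P' : Measure Ω') [IsProbabilityMeasure P']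
    (x : ℤ → Ω → EuclideanSpace ℝ (Fin m)) (y : ℤ → Ω' → EuclideanSpace ℝ (Fin m))
    (hx : ∀ k, Measurable (x k)) (hy : ∀ k, Measurable (y k))
    (hxs : SpectralWasserstein.IsStationary P x) (hys : SpectralWasserstein.IsStationary P' y)
    (g : ℕ → ℝ → ℝ≥0)
    (hxe : SpectralWasserstein.IsEllipticalProcess P x g)
    (hye : SpectralWasserstein.IsEllipticalProcess P' y g)
    (hxsum : ∀ w : ℝ, Summable (SpectralWasserstein.spectrumTerm P x w))
    (hysum : ∀ w : ℝ, Summable (SpectralWasserstein.spectrumTerm P' y w))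
    (hxpos : ∀ w : ℝ, (SpectralWasserstein.powerSpectrum P x w).PosDef)
    (hypos : ∀ w : ℝ, (SpectralWasserstein.powerSpectrum P' y w).PosDef) :
    IntervalIntegrable
      (fun w : ℝ => (SpectralWasserstein.buresMatrix (SpectralWasserstein.powerSpectrum P x w)
        (SpectralWasserstein.powerSpectrum P' y w)).trace.re) volume 0 (2 * Real.pi) ∧
    SpectralWasserstein.avgWasserstein 2
        (SpectralWasserstein.processLaw P x) (SpectralWasserstein.processLaw P' y) =
      ENNReal.ofReal (√(1 / (2 * Real.pi) * ∫ w in (0 : ℝ)..(2 * Real.pi),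
        (SpectralWasserstein.buresMatrix (SpectralWasserstein.powerSpectrum P x w)
          (SpectralWasserstein.powerSpectrum P' y w)).trace.re)) := by
  have hΦ := SpectralWasserstein.isRealSymbol_powerSpectrum hxsum
  have hΨ := SpectralWasserstein.isRealSymbol_powerSpectrum hysum
  have hcont := SpectralWasserstein.continuous_buresMatrix hΦ hΨ hxpos hypos
  refine ⟨(Complex.continuous_re.comp hcont.matrix_trace).intervalIntegrable _ _, ?_⟩
  obtain ⟨η, hlaw, hη⟩ := SpectralWasserstein.exists_procOf_law_eq hx hy hxs hys hxe hye
    hxsum hysum hxpos hypos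
  obtain ⟨γ, hγ, hcost⟩ := SpectralWasserstein.exists_coupling_lintegral_eq hx
    (SpectralWasserstein.measurable_procOf η) hxs.memLp (SpectralWasserstein.memLp_procOf η)
  rw [hlaw] at hγ
  simp only [SpectralWasserstein.procVec_procOf, hη, SpectralWasserstein.cesaro_const] at hcost
  have hnonneg := (Finset.sum_nonneg fun _ _ => sq_nonneg _).trans_eq (hη 0)
  rw [Real.sqrt_eq_rpow]
  change _ = ENNReal.ofReal (SpectralWasserstein.meanTrace _ ^ (1 / 2 : ℝ))
  rw [← ENNReal.ofReal_rpow_of_nonneg hnonneg (by norm_num), SpectralWasserstein.avgWasserstein]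
  congr 1
  refine le_antisymm (iInf₂_le_of_le γ hγ ?_) (le_iInf₂ fun γ' hγ' => ?_)
  · simp only [hcost, limsup_const, le_refl]
  · exact SpectralWasserstein.ofReal_meanTrace_buresMatrix_le_of_mem_couplings hx hy hxs hys
      hxsum hysum hxpos hypos hγ'
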